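/- **Nets.** Fix a countably infinite set of ports, here $\mathbb N$. A *wire* is an unordered pair of ports, a *loop* if they are equal and *proper* otherwise. A *cell* is $(\alpha,p_0,p_1,p_2)$ with $\alpha\in\{\delta,\zeta\}$ (binary) or $(\varepsilon,p_0)$; $p_0$ is its principal port, $p_1,p_2$ are its auxiliary ports. A *net* $\mu$ consists of finitely many cells and finitely many wires such that each port occurs at most twice in them (a loop counts as two occurrences of its port) and each port that occurs lies in exactly one wire. Ports occurring exactly once are *free*; they form the *interface*, a finite subset of $\mathbb N$. **$\beta$-reduction** $\mu\to^*\mu'$ is the reflexive-transitive closure of the rewriting of *active pairs*, i.e. pairs of cells whose principal ports are joined by a wire. For two binary cells with the same symbol, both cells and the joining wire are erased, and the auxiliary ports with equal numbers are connected to each other; two $\varepsilon$ cells and the wire joining them are erased; for binary cells $(\alpha,p,x_1,x_2)$, $(\beta,q,y_1,y_2)$ with $\alpha\neq\beta$, the pair is replaced by $\beta$ cells with principal ports $x_1,x_2$ and $\alpha$ cells with principal ports $y_1,y_2$, auxiliary port $j$ of the $\beta$ cell at $x_i$ being wired to auxiliary port $i$ of the $\alpha$ cell at $y_j$ (the new ports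 being fresh); for $(\varepsilon,p)$ and $(\alpha,q,y_1,y_2)$, the pair is replaced by $\varepsilon$ cells at $y_1$ and $y_2$. **Observable axioms.** A *tree* is a single wire (from its root to its only leaf), a single $\varepsilon$ cell (with no leaf), or $\alpha(\tau_1,\tau_2)$, i.e. a binary cell with trees rooted at its two auxiliary ports; its root is then connected to the principal port of the cell. Let $\mathbf W=\{\mathbf p,\mathbf q\}^*$. A leaf $l$ of a tree gets a pair of words in $\mathbf W\times\mathbf W$: the pair of empty words for a single wire; for $\delta(\tau_1,\tau_2)$ (resp. $\zeta(\tau_1,\tau_2)$), the pair of $l$ in the subtree $\tau_k$ to which it belongs, with the letter $\mathbf p$ (if $k=1$) or $\mathbf q$ (if $k=2$) prefixed to its first (resp. second) component. A *proper axiom* is a proper wire $\{p,q\}$ neither of whose ports is principal. It is *observable* if $p$ is a leaf of a tree of $\mu$ rooted at a free port $i$ and $q$ is a leaf of a tree of $\mu$ rooted at a free port $j$; its *address* is then the unordered pair $s@i\frown t@j$, where $s,t$ are the pairs of words of these leaves. Let $\mathcal O^*(\mu)$ be the set of the addresses of all observable axioms of all $\mu'$ with $\mu\to^*\mu'$. **Edifices.**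 Let $\mathcal C=\{\mathbf p,\mathbf q\}^{\mathbb N}$. A *pillar* $u@i$ is an element $(u,i)$ of $(\mathcal C\times\mathcal C)\times\mathbb N$, an *arch* $\xi\frown\upsilon$ is an unordered pair of pillars, an *edifice* is a set of arches. The edifice of a net $\mu$ is $$\mathcal E(\mu)=\bigcup_{s@i\frown t@j\,\in\,\mathcal O^*(\mu)}\{\,sw@i\frown tw@j \;:\; w\in\mathcal C\times\mathcal C\,\},$$ where concatenation is componentwise. **Feedback and trace.** A *feedback* is a fixpoint-free partial involution $\sigma$ on $\mathbb N$ with finite domain. It is a feedback *for* $\mu$ if $\operatorname{dom}\sigma$ is contained in the interface of $\mu$; then $\sigma[\mu]$ is the net obtained from $\mu$ by connecting the free ports $i$ and $\sigma(i)$ for all $i\in\operatorname{dom}\sigma$, the other free ports keeping their names. A *trace sequence* of an edifice $E$ along $\sigma$ is a non-empty finite sequence $a_1,\dots,a_n$ of arches of $E$, written $a_k=u_k@i_k\frown v_k@j_k$, such that for all $2\le k\le n$ one has $j_{k-1}\in\operatorname{dom}\sigma$, $i_k=\sigma(j_{k-1})$ and $u_k=v_{k-1}$. It is *visible* if $i_1,j_n\notin\operatorname{dom}\sigma$,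 and it *generates* the arch $u_1@i_1\frown v_n@j_n$. The *trace* $\operatorname{Tr}_\sigma(E)$ is the set of all arches generated by visible trace sequences of $E$ along $\sigma$. **Theorem.** For every net $\mu$ (cut-free or not, total or not) and every feedback $\sigma$ for $\mu$, $$\mathcal E(\sigma[\mu])=\operatorname{Tr}_\sigma(\mathcal E(\mu)).$$ -/

import Mathlib

/-! Symmetric interaction combinators, edifices and their trace. -/

namespace SymComb

/-! ### Nets -/

/-- Ports: a denumerable set containing the positive integers. -/
abbrev Port := ℕ

/-- The two binary symbols. The only other symbol is the nullary `ε`, see `Cell.eps`. -/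
inductive BinSymbol
  | delta
  | zeta
  deriving DecidableEq

/-- Cells: `bin α p₀ p₁ p₂` is a binary cell with principal port `p₀` and auxiliary ports
`p₁`, `p₂` (numbered 1 and 2); `eps p₀` is an `ε` cell with principal port `p₀`. -/
inductive Cell
  | bin (α : BinSymbol) (p₀ p₁ p₂ : Port)
  | eps (p₀ : Port)
  deriving DecidableEq

namespace Cell

def ports : Cell → Multiset Port
  | bin _ p₀ p₁ p₂ => {p₀, p₁, p₂}
  | eps p₀ => {p₀}

def principal : Cell → Port
  | bin _ p₀ _ _ => p₀
  | eps p₀ => p₀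

end Cell

/-- Finitely many cells and finitely many wires. A wire is an unordered pair of ports; it is a
loop if the two are equal, and proper otherwise. -/
structure PreNet where
  cells : Finset Cell
  wires : Finset (Sym2 Port)

namespace PreNet

/-- The number of occurrences of a port in the cells and the wires.
Both extremities of a loop count, so its port occurs twice in it. -/
def occ (μ : PreNet) (p : Port) : ℕ :=
  ∑ c ∈ μ.cells, c.ports.count p + ∑ w ∈ μ.wires, w.toMultiset.count p

/-- Each port appears at most twice, and if it appears at all it appears in exactly one wire. -/
structure IsNet (μ : PreNet) : Prop where
  occ_le_two : ∀ p, μ.occ p ≤ 2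
  existsUnique_wire : ∀ p, 0 < μ.occ p → ∃! w, w ∈ μ.wires ∧ p ∈ w

/-- The interface: the set of free ports. -/
def interface (μ : PreNet) : Set Port := {p | μ.occ p = 1}

end PreNet

/-! ### Feedbacks, and plugging a feedback into a net -/

/-- A feedback function: a fixpoint-free partial involution of finite domain `dom` on `ℕ`.
The values of `toFun` outside `dom` are irrelevant. -/
structure Feedback where
  dom : Finset ℕ
  toFun : ℕ → ℕ
  mem_dom : ∀ i ∈ dom, toFun i ∈ dom
  ne_self : ∀ i ∈ dom, toFun i ≠ i
  invol : ∀ i ∈ dom, toFun (toFun i) = i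

instance : CoeFun Feedback fun _ => ℕ → ℕ := ⟨Feedback.toFun⟩

namespace PreNet

/-- `μ.Linked σ a b`: one goes from `a` to `b` by alternately following wires of `μ` and
connections `i — σ i`, starting and ending with a wire. -/
inductive Linked (μ : PreNet) (σ : Feedback) : Port → Port → Prop
  | wire {a b : Port} : s(a, b) ∈ μ.wires → Linked μ σ a b
  | step {a i b : Port} : Linked μ σ a i → i ∈ σ.dom → s(σ i, b) ∈ μ.wires → Linked μ σ a b

/-- The wires that arise when the free ports `i` and `σ i` of `μ` are connected, for all
`i ∈ dom σ`. A maximal chain of wires becomes a single wire between its two ends; a closed chain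
becomes a loop, whose port is (by convention) the smallest one in the closed chain. -/
inductive PlugWire (μ : PreNet) (σ : Feedback) : Sym2 Port → Prop
  | chain {a b : Port} : μ.Linked σ a b → a ∉ σ.dom → b ∉ σ.dom → PlugWire μ σ s(a, b)
  | loop {i : Port} : i ∈ σ.dom → μ.Linked σ i (σ i) →
      (∀ k, μ.Linked σ i k → i ≤ k ∧ i ≤ σ k) → PlugWire μ σ s(i, i)

open Classical in
/-- Plugging the feedback `σ` into `μ`: the free port `i` of `μ` is connected to `σ i` for all
`i ∈ dom σ`; every other free port stays free, under the same name. -/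
noncomputable def plug (μ : PreNet) (σ : Feedback) : PreNet where
  cells := μ.cells
  wires := ((μ.wires.biUnion Sym2.toFinset).sym2).filter (μ.PlugWire σ)

theorem mem_wirePorts {μ : PreNet} {p : Port} :
    p ∈ μ.wires.biUnion Sym2.toFinset ↔ ∃ q, s(p, q) ∈ μ.wires := by
  simp only [Finset.mem_biUnion, Sym2.mem_toFinset]
  constructor
  · rintro ⟨w, hw, q, rfl⟩
    exact ⟨q, hw⟩
  · rintro ⟨q, hq⟩
    exact ⟨_, hq, Sym2.mem_mk_left _ _⟩

theorem Linked.left {μ : PreNet} {σ : Feedback} {a b : Port} (h : μ.Linked σ a b) :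
    ∃ q, s(a, q) ∈ μ.wires := by
  induction h with
  | wire h => exact ⟨_, h⟩
  | step _ _ _ ih => exact ih

theorem Linked.right {μ : PreNet} {σ : Feedback} {a b : Port} (h : μ.Linked σ a b) :
    ∃ q, s(b, q) ∈ μ.wires := by
  cases h with
  | wire h => exact ⟨_, Sym2.eq_swap ▸ h⟩
  | step _ _ h => exact ⟨_, Sym2.eq_swap ▸ h⟩

theorem mem_plug_wires {μ : PreNet} {σ : Feedback} {w : Sym2 Port} :
    w ∈ (μ.plug σ).wires ↔ μ.PlugWire σ w := by
  simp only [plug, Finset.mem_filter, and_iff_right_iff_imp]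
  rintro (⟨h, -, -⟩ | ⟨-, h, -⟩)
  · exact Finset.mk_mem_sym2_iff.2 ⟨mem_wirePorts.2 h.left, mem_wirePorts.2 h.right⟩
  · exact Finset.mk_mem_sym2_iff.2 ⟨mem_wirePorts.2 h.left, mem_wirePorts.2 h.left⟩

theorem IsNet.wire_unique {μ : PreNet} (h : μ.IsNet) {p a b : Port}
    (ha : s(p, a) ∈ μ.wires) (hb : s(p, b) ∈ μ.wires) : a = b := by
  have hp : 0 < μ.occ p := by
    refine Nat.lt_of_lt_of_le ?_ (Nat.le_add_left _ _)
    refine Nat.lt_of_lt_of_le ?_ (Finset.single_le_sum (f := fun w : Sym2 Port =>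
      w.toMultiset.count p) (fun _ _ => Nat.zero_le _) ha)
    simp [Multiset.count_pos]
  obtain ⟨w, -, hw⟩ := h.existsUnique_wire p hp
  have h1 := hw _ ⟨ha, Sym2.mem_mk_left _ _⟩
  have h2 := hw _ ⟨hb, Sym2.mem_mk_left _ _⟩
  exact Sym2.congr_right.1 (h1.trans h2.symm)

/-- The occurrences in wires, when there is only one wire through `p`. -/
theorem wireOcc_eq {W : Finset (Sym2 Port)} {p a : Port} (ha : s(p, a) ∈ W)
    (hu : ∀ w ∈ W, p ∈ w → w = s(p, a)) :
    ∑ w ∈ W, w.toMultiset.count p = if a = p then 2 else 1 := by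
  rw [Finset.sum_eq_single_of_mem _ ha]
  · split_ifs with h
    · subst h; simp [Sym2.toMultiset]
    · simp [Sym2.toMultiset, Ne.symm h]
  · intro w hw hne
    rw [Multiset.count_eq_zero, Sym2.mem_toMultiset]
    exact fun hp => hne (hu w hw hp)

theorem IsNet.occ_eq {μ : PreNet} (h : μ.IsNet) {p a : Port} (ha : s(p, a) ∈ μ.wires) :
    μ.occ p = ∑ c ∈ μ.cells, c.ports.count p + if a = p then 2 else 1 := by
  rw [occ, wireOcc_eq ha]
  intro w hw hp
  obtain ⟨b, rfl⟩ := hp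
  rw [h.wire_unique ha hw]

theorem IsNet.exists_wire {μ : PreNet} (h : μ.IsNet) {p : Port} (hp : 0 < μ.occ p) :
    ∃ a, s(p, a) ∈ μ.wires := by
  obtain ⟨w, ⟨hw, b, rfl⟩, -⟩ := h.existsUnique_wire p hp
  exact ⟨b, hw⟩

/-- One step of a chain: through a connection, then through a wire. -/
def Next (μ : PreNet) (σ : Feedback) (x y : Port) : Prop := x ∈ σ.dom ∧ s(σ x, y) ∈ μ.wires

theorem linked_iff {μ : PreNet} {σ : Feedback} {a b : Port} :
    μ.Linked σ a b ↔ ∃ c, s(a, c) ∈ μ.wires ∧ Relation.ReflTransGen (μ.Next σ) c b := by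
  constructor
  · intro h
    induction h with
    | wire h => exact ⟨_, h, .refl⟩
    | step _ hi hw ih =>
      obtain ⟨c, hc, hr⟩ := ih
      exact ⟨c, hc, hr.tail ⟨hi, hw⟩⟩
  · rintro ⟨c, hc, hr⟩
    induction hr with
    | refl => exact .wire hc
    | tail _ h ih => exact .step ih h.1 h.2

theorem IsNet.next_unique {μ : PreNet} (h : μ.IsNet) {σ : Feedback} :
    Relator.RightUnique (μ.Next σ) := fun _ _ _ h1 h2 => h.wire_unique h1.2 h2.2

theorem IsNet.linked_unique {μ : PreNet} (h : μ.IsNet) {σ : Feedback} {p a b : Port}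
    (ha : μ.Linked σ p a) (hb : μ.Linked σ p b) (ha' : a ∉ σ.dom) (hb' : b ∉ σ.dom) : a = b := by
  obtain ⟨c, hc, ha⟩ := linked_iff.1 ha
  obtain ⟨d, hd, hb⟩ := linked_iff.1 hb
  obtain rfl := h.wire_unique hc hd
  have key : ∀ {x y : Port}, x ∉ σ.dom → Relation.ReflTransGen (μ.Next σ) x y → x = y := by
    intro x y hx hxy
    rcases Relation.ReflTransGen.cases_head hxy with h | ⟨z, hz, -⟩
    · exact h
    · exact (hx hz.1).elim
  rcases Relation.ReflTransGen.total_of_right_unique h.next_unique ha hb with h1 | h1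
  · exact key ha' h1
  · exact (key hb' h1).symm

theorem IsNet.exists_linked {μ : PreNet} (h : μ.IsNet) {σ : Feedback}
    (hσ : ∀ i ∈ σ.dom, μ.occ i = 1) {p : Port} (hp : p ∉ σ.dom) (hp0 : 0 < μ.occ p) :
    ∃ b, b ∉ σ.dom ∧ μ.Linked σ p b := by
  obtain ⟨a, ha⟩ := h.exists_wire hp0
  by_contra! hcon
  have hdom : ∀ x, Relation.ReflTransGen (μ.Next σ) a x → x ∈ σ.dom := by
    intro x hx
    by_contra hx'
    exact hcon x hx' (linked_iff.2 ⟨a, ha, hx⟩)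
  let S : Set Port := {x | Relation.ReflTransGen (μ.Next σ) a x}
  have hS : S.Finite := σ.dom.finite_toSet.subset fun x hx => hdom x hx
  have hnext : ∀ x ∈ σ.dom, ∃ y, s(σ x, y) ∈ μ.wires := fun x hx =>
    h.exists_wire (by rw [hσ _ (σ.mem_dom x hx)]; exact Nat.one_pos)
  choose! f hf using hnext
  have hmaps : Set.MapsTo f S S := fun x hx => hx.tail ⟨hdom x hx, hf x (hdom x hx)⟩
  have hinj : Set.InjOn f S := by
    intro x hx y hy hxy
    have h1 := hf x (hdom x hx)
    have h2 := hf y (hdom y hy)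
    rw [hxy] at h1
    have h3 := h.wire_unique (Sym2.eq_swap ▸ h1) (Sym2.eq_swap ▸ h2)
    rw [← σ.invol x (hdom x hx), h3, σ.invol y (hdom y hy)]
  have hsurj : Set.SurjOn f S S :=
    (hS.injOn_iff_bijOn_of_mapsTo hmaps).1 hinj |>.surjOn
  obtain ⟨x, hx, hxa⟩ := hsurj (show a ∈ S from .refl)
  have h1 := hf x (hdom x hx)
  rw [hxa] at h1
  have := h.wire_unique (Sym2.eq_swap ▸ h1) (Sym2.eq_swap ▸ ha)
  exact hp (this ▸ σ.mem_dom x (hdom x hx))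

theorem IsNet.not_turn {μ : PreNet} (h : μ.IsNet) {σ : Feedback}
    (hσ : ∀ i ∈ σ.dom, μ.occ i = 1) {x y : Port}
    (hxy : Relation.ReflTransGen (μ.Next σ) x y) : x ∈ σ.dom → y ≠ σ x := by
  have hend : ∀ x y, μ.Next σ x y → y ≠ σ x := by
    rintro x y ⟨hx, hw⟩ rfl
    have h1 := h.occ_eq hw
    rw [hσ _ (σ.mem_dom x hx), if_pos rfl] at h1
    omega
  suffices H : ∀ n, ∀ x y (g : ℕ → Port), x ∈ σ.dom → g 0 = x → g n = y →
      (∀ k < n, μ.Next σ (g k) (g (k + 1))) → y ≠ σ x by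
    intro hx
    have : ∃ n, ∃ g : ℕ → Port, g 0 = x ∧ g n = y ∧ ∀ k < n, μ.Next σ (g k) (g (k + 1)) := by
      clear hx
      induction hxy with
      | refl => exact ⟨0, fun _ => x, rfl, rfl, by simp⟩
      | @tail b c _ hbc ih =>
        obtain ⟨n, g, h0, hn, hg⟩ := ih
        refine ⟨n + 1, fun k => if k ≤ n then g k else c, by simp [h0], by simp, ?_⟩
        intro k hk
        rcases Nat.lt_succ_iff_lt_or_eq.1 hk with hk | rfl
        · simpa [hk.le, Nat.succ_le_of_lt hk] using hg k hk
        · simpa [hn] using hbc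
    obtain ⟨n, g, h0, hn, hg⟩ := this
    exact H n x y g hx h0 hn hg
  intro n
  induction n using Nat.strong_induction_on with
  | _ n ih =>
    rintro x y g hx h0 hn hg rfl
    rcases n with _ | _ | n
    · exact σ.ne_self x hx (hn ▸ h0)
    · have := hg 0 Nat.one_pos
      rw [h0, hn] at this
      exact hend _ _ this rfl
    · have h1 := hg 0 (by omega)
      have h2 := hg (n + 1) (by omega)
      rw [h0] at h1
      rw [hn] at h2
      have h3 : σ (g (n + 1)) = g 1 := h.wire_unique (Sym2.eq_swap ▸ h2.2) h1.2
      have h4 : g 1 ∈ σ.dom := h3 ▸ σ.mem_dom _ h2.1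
      refine ih n (by omega) (g 1) (g (n + 1)) (fun k => g (k + 1)) h4 rfl rfl
        (fun k hk => hg (k + 1) (by omega)) ?_
      rw [← h3, σ.invol _ h2.1]

/-- Plugging a feedback into a net yields a net. -/
theorem IsNet.plug {μ : PreNet} (h : μ.IsNet) {σ : Feedback}
    (hσ : ∀ i ∈ σ.dom, μ.occ i = 1) : (μ.plug σ).IsNet := by
  have hcell : ∀ i ∈ σ.dom, ∑ c ∈ μ.cells, c.ports.count i = 0 := by
    intro i hi
    have hi1 := hσ i hi
    obtain ⟨a, ha⟩ := h.exists_wire (p := i) (by omega)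
    rw [h.occ_eq ha] at hi1
    split_ifs at hi1 <;> omega
  have hdom : ∀ i ∈ σ.dom, ∀ w, μ.PlugWire σ w → i ∈ w → w = s(i, i) := by
    rintro i hi w (⟨-, ha, hb⟩ | ⟨-, -, -⟩) hw
    · rcases Sym2.mem_iff.1 hw with rfl | rfl
      · exact (ha hi).elim
      · exact (hb hi).elim
    · rcases Sym2.mem_iff.1 hw with rfl | rfl <;> rfl
  have hsymm : ∀ a b, b ∉ σ.dom → μ.Linked σ a b → μ.Linked σ b a := by
    intro a b hb hab
    have key : ∀ c d, Relation.ReflTransGen (μ.Next σ) c d → ∀ a, s(a, c) ∈ μ.wires →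
        μ.Linked σ d a := by
      intro c d hcd
      induction hcd with
      | refl => exact fun a ha => .wire (Sym2.eq_swap ▸ ha)
      | @tail x y hcx hxy ih =>
        intro a ha
        have h1 := ih a ha
        obtain ⟨e, he, her⟩ := linked_iff.1 h1
        refine linked_iff.2 ⟨σ x, Sym2.eq_swap ▸ hxy.2, .head ⟨σ.mem_dom _ hxy.1, ?_⟩ her⟩
        rwa [σ.invol _ hxy.1]
    obtain ⟨c, hc, hcb⟩ := linked_iff.1 hab
    exact key c b hcb a hc
  have hout : ∀ p ∉ σ.dom, 0 < μ.occ p → ∃ b, s(p, b) ∈ (μ.plug σ).wires ∧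
      (∀ w ∈ (μ.plug σ).wires, p ∈ w → w = s(p, b)) ∧ μ.Linked σ p b := by
    intro p hp hp0
    obtain ⟨b, hb, hpb⟩ := h.exists_linked hσ hp hp0
    refine ⟨b, mem_plug_wires.2 (.chain hpb hp hb), ?_, hpb⟩
    intro w hw hpw
    rcases mem_plug_wires.1 hw with ⟨hl, ha, hb'⟩ | ⟨hi, -, -⟩
    · rcases Sym2.mem_iff.1 hpw with rfl | rfl
      · rw [h.linked_unique hl hpb hb' hb]
      · rw [h.linked_unique (hsymm _ _ hp hl) hpb ha hb, Sym2.eq_swap]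
    · rcases Sym2.mem_iff.1 hpw with rfl | rfl <;> exact (hp hi).elim
  have hpos : ∀ p, 0 < (μ.plug σ).occ p → 0 < ∑ c ∈ μ.cells, c.ports.count p ∨
      ∃ w ∈ (μ.plug σ).wires, p ∈ w := by
    intro p hp
    by_contra! hcon
    obtain ⟨h1, h2⟩ := hcon
    have h3 : ∑ w ∈ (μ.plug σ).wires, w.toMultiset.count p = 0 :=
      Finset.sum_eq_zero fun w hw => by
        rw [Multiset.count_eq_zero, Sym2.mem_toMultiset]; exact h2 w hw
    have h4 : (μ.plug σ).occ p = ∑ c ∈ μ.cells, c.ports.count p +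
      ∑ w ∈ (μ.plug σ).wires, w.toMultiset.count p := rfl
    omega
  have hoccpos : ∀ p, 0 < (μ.plug σ).occ p → 0 < μ.occ p := by
    intro p hp
    rcases hpos p hp with h1 | ⟨w, hw, hpw⟩
    · exact Nat.lt_of_lt_of_le h1 (Nat.le_add_right _ _)
    · obtain ⟨q, hq⟩ : ∃ q, s(p, q) ∈ μ.wires := by
        rcases mem_plug_wires.1 hw with ⟨hl, -, -⟩ | ⟨-, hl, -⟩
        · rcases Sym2.mem_iff.1 hpw with rfl | rfl
          exacts [hl.left, hl.right]
        · rcases Sym2.mem_iff.1 hpw with rfl | rfl <;> exact hl.left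
      rw [h.occ_eq hq]
      split_ifs <;> omega
  constructor
  · intro p
    rcases Nat.eq_zero_or_pos ((μ.plug σ).occ p) with h0 | h0
    · omega
    have h4 : (μ.plug σ).occ p = ∑ c ∈ μ.cells, c.ports.count p +
      ∑ w ∈ (μ.plug σ).wires, w.toMultiset.count p := rfl
    by_cases hp : p ∈ σ.dom
    · rcases hpos p h0 with h1 | ⟨w, hw, hpw⟩
      · have := hcell p hp; omega
      · obtain rfl := hdom p hp w (mem_plug_wires.1 hw) hpw
        rw [h4, hcell p hp, wireOcc_eq hw fun w hw => hdom p hp w (mem_plug_wires.1 hw)]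
        simp
    · obtain ⟨b, hb, hu, hl⟩ := hout p hp (hoccpos p h0)
      rw [h4, wireOcc_eq hb hu]
      have h2 := h.occ_le_two p
      obtain ⟨a, ha, hab⟩ := linked_iff.1 hl
      rw [h.occ_eq ha] at h2
      split_ifs with hbp
      · subst hbp
        rcases Relation.ReflTransGen.cases_tail hab with rfl | ⟨x, hax, hxb⟩
        · rw [if_pos rfl] at h2
          exact h2
        · exfalso
          have h5 : σ x = a := h.wire_unique (Sym2.eq_swap ▸ hxb.2) ha
          refine h.not_turn hσ hax (h5 ▸ σ.mem_dom _ hxb.1) ?_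
          rw [← h5, σ.invol _ hxb.1]
      · split_ifs at h2 <;> omega
  · intro p h0
    by_cases hp : p ∈ σ.dom
    · rcases hpos p h0 with h1 | ⟨w, hw, hpw⟩
      · have := hcell p hp; omega
      · obtain rfl := hdom p hp w (mem_plug_wires.1 hw) hpw
        exact ⟨_, ⟨hw, hpw⟩, fun w hw => hdom p hp w (mem_plug_wires.1 hw.1) hw.2⟩
    · obtain ⟨b, hb, hu, -⟩ := hout p hp (hoccpos p h0)
      exact ⟨_, ⟨hb, Sym2.mem_mk_left _ _⟩, fun w hw => hu w hw.1 hw.2⟩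

end PreNet

/-- Nets. The interface may be any finite set of natural numbers. -/
structure Net extends PreNet where
  isNet : toPreNet.IsNet

/-- The application of the feedback `σ` for `μ` to `μ`. -/
noncomputable def Net.plug (μ : Net) (σ : Feedback) (hσ : ↑σ.dom ⊆ μ.interface) : Net where
  toPreNet := μ.toPreNet.plug σ
  isNet := μ.isNet.plug hσ

/-! ### Reduction -/

/-- One-step `β`-reduction: an active pair of `μ` (two cells whose principal ports `p`, `q` are
connected by a wire) is rewritten. New ports introduced by a commutation are arbitrary fresh
names, so that the relation is independent of the choice of names. -/
inductive Step (μ : Net) : Net → Prop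
  /-- Two binary cells with the same symbol: the pair is erased, and the wires of the auxiliary
  ports with the same number are joined. -/
  | annihilate {μ' : Net} (α : BinSymbol) (p x₁ x₂ q y₁ y₂ : Port) (σ : Feedback)
      (hc : .bin α p x₁ x₂ ∈ μ.cells) (hd : .bin α q y₁ y₂ ∈ μ.cells) (hw : s(p, q) ∈ μ.wires)
      (hdom : σ.dom = {x₁, x₂, y₁, y₂}) (h₁ : σ x₁ = y₁) (h₂ : σ x₂ = y₂)
      (hμ' : μ'.toPreNet = PreNet.plug
        { cells := μ.cells \ {.bin α p x₁ x₂, .bin α q y₁ y₂}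
          wires := μ.wires \ {s(p, q)} } σ) : Step μ μ'
  /-- Two `ε` cells: the pair is erased. -/
  | annihilateEps {μ' : Net} (p q : Port)
      (hc : .eps p ∈ μ.cells) (hd : .eps q ∈ μ.cells) (hw : s(p, q) ∈ μ.wires)
      (hμ' : μ'.toPreNet =
        { cells := μ.cells \ {.eps p, .eps q}
          wires := μ.wires \ {s(p, q)} }) : Step μ μ'
  /-- Two binary cells with different symbols: each cell is duplicated through the other one. -/
  | commute {μ' : Net} (α β : BinSymbol) (hαβ : α ≠ β) (p x₁ x₂ q y₁ y₂ : Port)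
      (a₁₁ a₁₂ a₂₁ a₂₂ b₁₁ b₁₂ b₂₁ b₂₂ : Port)
      (hc : .bin α p x₁ x₂ ∈ μ.cells) (hd : .bin β q y₁ y₂ ∈ μ.cells) (hw : s(p, q) ∈ μ.wires)
      (hnodup : [a₁₁, a₁₂, a₂₁, a₂₂, b₁₁, b₁₂, b₂₁, b₂₂].Nodup)
      (hfresh : ∀ r ∈ [a₁₁, a₁₂, a₂₁, a₂₂, b₁₁, b₁₂, b₂₁, b₂₂], μ.occ r = 0)
      (hμ' : μ'.toPreNet =
        { cells := (μ.cells \ {.bin α p x₁ x₂, .bin β q y₁ y₂}) ∪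
            {.bin β x₁ a₁₁ a₁₂, .bin β x₂ a₂₁ a₂₂, .bin α y₁ b₁₁ b₁₂, .bin α y₂ b₂₁ b₂₂}
          wires := (μ.wires \ {s(p, q)}) ∪
            {s(a₁₁, b₁₁), s(a₁₂, b₂₁), s(a₂₁, b₁₂), s(a₂₂, b₂₂)} }) : Step μ μ'
  /-- An `ε` cell and a binary cell: the `ε` cell is duplicated and the binary one is erased. -/
  | erase {μ' : Net} (α : BinSymbol) (p q y₁ y₂ : Port)
      (hc : .eps p ∈ μ.cells) (hd : .bin α q y₁ y₂ ∈ μ.cells) (hw : s(p, q) ∈ μ.wires)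
      (hμ' : μ'.toPreNet =
        { cells := (μ.cells \ {.eps p, .bin α q y₁ y₂}) ∪ {.eps y₁, .eps y₂}
          wires := μ.wires \ {s(p, q)} }) : Step μ μ'

/-- `β`-reduction. -/
def Reduces : Net → Net → Prop := Relation.ReflTransGen Step

/-! ### Observable axioms and their addresses -/

/-- The two letters of binary words. -/
inductive Letter
  | p
  | q

/-- Pairs of finite words. -/
abbrev FinPair := List Letter × List Letter

/-- Pairs of infinite words, i.e. the elements of `𝒞 × 𝒞`. -/
abbrev InfPair := Stream' Letter × Stream' Letter

/-- Prefixing a pair of finite words with a letter, in the first component for `δ` and in the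
second one for `ζ`. -/
def consLetter (l : Letter) : BinSymbol → FinPair → FinPair
  | .delta, s => (l :: s.1, s.2)
  | .zeta, s => (s.1, l :: s.2)

/-- Trees; each leaf carries the port at which it is. -/
inductive Tree
  | leaf (p : Port)
  | eps
  | node (α : BinSymbol) (τ₁ τ₂ : Tree)

/-- `τ.Br p s`: the port `p` is a leaf of `τ`, and `s` is the pair of words associated with it. -/
inductive Tree.Br : Tree → Port → FinPair → Prop
  | leaf (p : Port) : Br (.leaf p) p ([], [])
  | left {α : BinSymbol} {τ₁ τ₂ : Tree} {p : Port} {s : FinPair} :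
      Br τ₁ p s → Br (.node α τ₁ τ₂) p (consLetter .p α s)
  | right {α : BinSymbol} {τ₁ τ₂ : Tree} {p : Port} {s : FinPair} :
      Br τ₂ p s → Br (.node α τ₁ τ₂) p (consLetter .q α s)

/-- `μ.ContainsTree r τ`: the net `μ` contains the tree `τ`, with root `r` and with its leaves at
the ports they carry. The trivial tree rooted at `r` has its leaf at `r` itself; the leaves of a
nontrivial tree are auxiliary ports of its cells. -/
inductive Net.ContainsTree (μ : Net) : Port → Tree → Prop
  | leaf (r : Port) : ContainsTree μ r (.leaf r)
  | eps {r p₀ : Port} : .eps p₀ ∈ μ.cells → s(r, p₀) ∈ μ.wires → ContainsTree μ r .eps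
  | node {α : BinSymbol} {r p₀ p₁ p₂ : Port} {τ₁ τ₂ : Tree} :
      .bin α p₀ p₁ p₂ ∈ μ.cells → s(r, p₀) ∈ μ.wires →
      ContainsTree μ p₁ τ₁ → ContainsTree μ p₂ τ₂ → ContainsTree μ r (.node α τ₁ τ₂)

/-- The wire `{p, q}` is a proper axiom: it is proper, and neither `p` nor `q` is the principal
port of a cell. -/
def Net.IsProperAxiom (μ : Net) (p q : Port) : Prop :=
  s(p, q) ∈ μ.wires ∧ p ≠ q ∧ ∀ c ∈ μ.cells, c.principal ≠ p ∧ c.principal ≠ q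

/-- Addresses: unordered pairs of elements `s ⊗ i`. -/
abbrev Address := Sym2 (FinPair × ℕ)

/-- The set of all addresses of the observable axioms of a net. -/
def Net.obs (μ : Net) : Set Address :=
  {x | ∃ (p q i j : Port) (τ τ' : Tree) (s t : FinPair),
    μ.IsProperAxiom p q ∧ i ∈ μ.interface ∧ j ∈ μ.interface ∧
    μ.ContainsTree i τ ∧ μ.ContainsTree j τ' ∧ τ.Br p s ∧ τ'.Br q t ∧ x = s((s, i), (t, j))}

/-- The addresses of all observable axioms appearing during the reduction of a net. -/
def Net.allObs (μ : Net) : Set Address := {x | ∃ μ', Reduces μ μ' ∧ x ∈ μ'.obs}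

/-! ### Edifices and their trace -/

/-- Pillars `u ⊗ i`, based at `i`. -/
abbrev Pillar := InfPair × ℕ

/-- Arches: unordered pairs of pillars. -/
abbrev Arch := Sym2 Pillar

/-- Edifices: sets of arches. -/
abbrev Edifice := Set Arch

/-- The concatenation `sw`. -/
def FinPair.append (s : FinPair) (w : InfPair) : InfPair :=
  (s.1 ++ₛ w.1, s.2 ++ₛ w.2)

/-- The vault generated by the address `s ⊗ i ⌢ t ⊗ j`: the set of the arches
`sw ⊗ i ⌢ tw ⊗ j`, for `w` in `𝒞 × 𝒞`. -/
def vault (x : Address) : Edifice :=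
  Set.range fun w : InfPair => x.map fun a => (FinPair.append a.1 w, a.2)

/-- The edifice of a net. -/
def Net.edifice (μ : Net) : Edifice := ⋃ x ∈ μ.allObs, vault x

/-- Trace sequences of `E` along `σ`, as lists of arches `(u ⊗ i, v ⊗ j)`, each of them presented
in the direction in which the sequence goes through it. -/
structure IsTraceSeq (σ : Feedback) (E : Edifice) (l : List (Pillar × Pillar)) : Prop where
  ne_nil : l ≠ []
  mem : ∀ a ∈ l, s(a.1, a.2) ∈ E
  /-- The chain and match conditions. -/
  chain_match : l.IsChain fun a b =>
    (a.2.2 ∈ σ.dom ∧ b.1.2 = σ a.2.2) ∧ b.1.1 = a.2.1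

/-- The trace of `E` along `σ`: the set of the arches generated by visible trace sequences. -/
def trace (σ : Feedback) (E : Edifice) : Edifice :=
  {a | ∃ (l : List (Pillar × Pillar)) (h : IsTraceSeq σ E l),
    ((l.head h.ne_nil).1.2 ∉ σ.dom ∧ (l.getLast h.ne_nil).2.2 ∉ σ.dom) ∧
    a = s((l.head h.ne_nil).1, (l.getLast h.ne_nil).2)}

end SymComb

/-! A net is a machine in which a token travels, carrying a pair of infinite words. The token
follows wires; going down through a binary cell, from its principal port, it loses the first letter
of the component of the cell's symbol and exits through the auxiliary port for this letter; going up
through an auxiliary port, it gains the corresponding letter. It is stuck at an `ε` cell.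

The edifice of a net is the set of the arches between the two ends of a run of the token from a free
port to a free port (`Net.mem_edifice_iff`), for two reasons.

* Runs are invariant under reduction. An active pair acts only by the crossings of the token from an
  auxiliary port of one cell to an auxiliary port of the other (`ActivePair.run_iff`): it gains a
  letter and then loses one. If the symbols are equal, both letters are the same, and the crossing
  is a jump along the wires that the annihilation joins (`ActivePair.run_annihilate_iff`). If the
  symbols differ, the letters are in different components, and the commuted cells do the same in
  the other order (`ActivePair.run_commute_iff`). Hence an observable axiom of a reduct, which is
  followed by a token going down the branch to one of its ports and up the branch from the other
  one, comes from a run of the net (`Reduces.exists_run`).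
* A run that never goes up to a cell and then down the next one goes down a branch, along an axiom
  and up a branch, so the axiom is observable. Any other run crosses an active pair; reducing it
  removes an occurrence of "up, down" from the list of moves or turns it into "down, up", at each
  crossing. This terminates, by the interpretation `weight` (`Net.exists_step_weight_lt`). No
  confluence or normalisation of the reduction is needed.

Finally, plugging a feedback into the net lets the token jump along the feedback
(`PreNet.run_plug_iff`). Grouping the steps of such a run between jumps turns it into a sequence of
runs of the net joined by jumps, which is a trace sequence; this is the Kleene algebra identity
`Alt.alt_alt`. -/

namespace SymComb

/-! ### Alternating paths -/

/-- A move of a token through a binary cell, recorded together with the principal port of the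
cell: downwards from the principal port to an auxiliary one, or upwards. -/
inductive Move
  | down (p : Port)
  | up (p : Port)

/-- Paths from `x` to `y` that alternate steps of `A` and steps of `B`, beginning and ending with
a step of `A`. Steps are labelled with lists of moves, and the label of a path is the
concatenation of the labels of its steps. -/
inductive Alt {S : Type*} (A B : S → S → List Move → Prop) : S → S → List Move → Prop
  | base {x y : S} {K : List Move} : A x y K → Alt A B x y K
  | cons {x b z y : S} {K K' L : List Move} :
      A x b K → B b z K' → Alt A B z y L → Alt A B x y (K ++ (K' ++ L))

namespace Alt

variable {S : Type*} {A B A' B' P P' : S → S → List Move → Prop} {x y z b : S}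
  {K K' L : List Move}

theorem mono (hA : A ≤ A') (hB : B ≤ B') (h : Alt A B x y L) : Alt A' B' x y L := by
  induction h with
  | base h => exact .base (hA _ _ _ h)
  | cons h₁ h₂ _ ih => exact .cons (hA _ _ _ h₁) (hB _ _ _ h₂) ih

theorem trans (h₁ : Alt A B x b K) (h₂ : B b z K') (h₃ : Alt A B z y L) :
    Alt A B x y (K ++ (K' ++ L)) := by
  induction h₁ with
  | base h => exact .cons h h₂ h₃
  | cons h h' _ ih => simpa using cons h h' (ih h₂)

/-- The Kleene algebra identity behind every decomposition of paths below. -/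
theorem alt_alt : Alt (Alt A B) P x y L ↔ Alt A (B ⊔ P) x y L := by
  constructor
  · intro h
    induction h with
    | base h => exact h.mono le_rfl le_sup_left
    | cons h₁ h₂ _ ih => exact (h₁.mono le_rfl le_sup_left).trans (Or.inr h₂) ih
  · intro h
    induction h with
    | base h => exact .base (.base h)
    | @cons x b z y K K' L h₁ h₂ _ ih =>
      rcases h₂ with h₂ | h₂
      · cases ih with
        | base h => exact .base (.cons h₁ h₂ h)
        | @cons _ _ _ _ K₁ K₂ L h h' h'' =>
          have := cons (Alt.cons h₁ h₂ h) h' h''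
          simpa using this
      · exact .cons (.base h₁) h₂ ih

theorem exists_map (hB : ∀ x y K, B x y K → ∃ K', B' x y K') (h : Alt A B x y L) :
    ∃ L', Alt A B' x y L' := by
  induction h with
  | base h => exact ⟨_, .base h⟩
  | cons h₁ h₂ _ ih =>
    obtain ⟨_, h₂'⟩ := hB _ _ _ h₂
    obtain ⟨_, ih⟩ := ih
    exact ⟨_, .cons h₁ h₂' ih⟩

theorem exists_symm (hA : ∀ x y K, A x y K → ∃ K', A y x K')
    (hB : ∀ x y K, B x y K → ∃ K', B y x K') (h : Alt A B x y L) : ∃ L', Alt A B y x L' := by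
  induction h with
  | base h =>
    obtain ⟨_, h⟩ := hA _ _ _ h
    exact ⟨_, .base h⟩
  | cons h₁ h₂ _ ih =>
    obtain ⟨_, h₁⟩ := hA _ _ _ h₁
    obtain ⟨_, h₂⟩ := hB _ _ _ h₂
    obtain ⟨_, ih⟩ := ih
    exact ⟨_, ih.trans h₂ (.base h₁)⟩

theorem forall_label {p : Move → Prop} (hA : ∀ x y K, A x y K → ∀ m ∈ K, p m)
    (hB : ∀ x y K, B x y K → ∀ m ∈ K, p m) (h : Alt A B x y L) : ∀ m ∈ L, p m := by
  induction h with
  | base h => exact hA _ _ _ h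
  | cons h₁ h₂ _ ih =>
    intro m hm
    simp only [List.mem_append] at hm
    rcases hm with hm | hm | hm
    exacts [hA _ _ _ h₁ m hm, hB _ _ _ h₂ m hm, ih m hm]

end Alt

/-- A polynomial interpretation of lists of moves, under which replacing an upward move followed
by a downward one by nothing, or by the same two moves in the other order, is a strict decrease
in every context. -/
def weight : List Move → ℕ → ℕ
  | [], n => n
  | .down _ :: L, n => weight L n + 1
  | .up _ :: L, n => 2 * weight L n

theorem weight_append (K L : List Move) (n : ℕ) : weight (K ++ L) n = weight K (weight L n) := by
  induction K with
  | nil => rfl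
  | cons m K ih => cases m <;> simp [weight, ih]

theorem weight_strictMono (K : List Move) : StrictMono (weight K) := by
  intro m n h
  induction K with
  | nil => exact h
  | cons o K ih => cases o <;> simpa [weight] using ih

/-- If the steps in `P` can be replaced by lighter ones in `P'`, then a path either becomes
lighter or makes no step in `P`. -/
theorem Alt.exists_weight_lt {S : Type*} {A B P P' : S → S → List Move → Prop} {x y : S}
    {L : List Move}
    (hP : ∀ x y K, P x y K → ∃ K', P' x y K' ∧ ∀ n, weight K' n < weight K n)
    (h : Alt A (B ⊔ P) x y L) :
    Alt A B x y L ∨ ∃ L', Alt A (B ⊔ P') x y L' ∧ ∀ n, weight L' n < weight L n := by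
  induction h with
  | base h => exact .inl (.base h)
  | @cons _ _ _ _ K K₁ L h₁ h₂ _ ih =>
    rcases h₂ with h₂ | h₂
    · rcases ih with ih | ⟨L', ih, hlt⟩
      · exact .inl (.cons h₁ h₂ ih)
      · refine .inr ⟨_, .cons h₁ (.inl h₂) ih, fun n => ?_⟩
        simp only [weight_append]
        exact weight_strictMono _ (weight_strictMono _ (hlt n))
    · obtain ⟨K', h₂', hlt⟩ := hP _ _ _ h₂
      right
      obtain ⟨L', ih', hle⟩ : ∃ L', Alt A (B ⊔ P') _ _ L' ∧ ∀ n, weight L' n ≤ weight L n := by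
        rcases ih with ih | ⟨L', ih, hlt'⟩
        · exact ⟨L, ih.mono le_rfl le_sup_left, fun _ => le_rfl⟩
        · exact ⟨L', ih, fun n => (hlt' n).le⟩
      refine ⟨_, .cons h₁ (.inr h₂') ih', fun n => ?_⟩
      simp only [weight_append]
      exact weight_strictMono _ ((hlt _).trans_le ((weight_strictMono K₁).monotone (hle n)))

/-! ### Runs of a token through a net -/

/-- The entry of a pair that a letter selects. -/
def pick {X : Type*} (x₁ x₂ : X) : Letter → X
  | .p => x₁
  | .q => x₂

/-- Prefixing a pair of infinite words with a letter, in the component of the given symbol. -/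
def pushLetter (l : Letter) : BinSymbol → InfPair → InfPair
  | .delta, u => (Stream'.cons l u.1, u.2)
  | .zeta, u => (u.1, Stream'.cons l u.2)

theorem append_consLetter (l : Letter) (α : BinSymbol) (s : FinPair) (w : InfPair) :
    FinPair.append (consLetter l α s) w = pushLetter l α (FinPair.append s w) := by
  cases α <;> rfl

theorem pushLetter_inj {l l' : Letter} {α : BinSymbol} {u u' : InfPair} :
    pushLetter l α u = pushLetter l' α u' ↔ l = l' ∧ u = u' := by
  cases α <;> simp only [pushLetter, Prod.ext_iff, Stream'.cons_injective2.eq_iff] <;> tauto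

/-- Letters pushed for different symbols go to different components, hence commute. -/
theorem pushLetter_eq_iff {α β : BinSymbol} (h : α ≠ β) {i j : Letter} {u v : InfPair} :
    pushLetter i α u = pushLetter j β v ↔
      ∃ w, u = pushLetter j β w ∧ v = pushLetter i α w := by
  constructor
  · intro e
    cases α <;> cases β <;> simp only [ne_eq, not_true_eq_false] at h <;>
      simp only [pushLetter, Prod.ext_iff] at e
    · exact ⟨(u.1, v.2), Prod.ext rfl e.2, Prod.ext e.1.symm rfl⟩
    · exact ⟨(v.1, u.2), Prod.ext e.1 rfl, Prod.ext rfl e.2.symm⟩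
  · rintro ⟨w, rfl, rfl⟩
    cases α <;> cases β <;> first | exact (h rfl).elim | rfl

/-- A token, i.e. a pillar, follows a wire. -/
def Wire (W : Finset (Sym2 Port)) (x y : Pillar) (K : List Move) : Prop :=
  s(x.2, y.2) ∈ W ∧ x.1 = y.1 ∧ K = []

/-- A token passes a binary cell. Going down, it leaves the letter of the auxiliary port through
which it exits; going up, it takes the letter of the one through which it enters. -/
inductive Pass (C : Finset Cell) : Pillar → Pillar → List Move → Prop
  | down {α : BinSymbol} {p x₁ x₂ : Port} (l : Letter) (u : InfPair) (h : .bin α p x₁ x₂ ∈ C) :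
      Pass C (pushLetter l α u, p) (u, pick x₁ x₂ l) [.down p]
  | up {α : BinSymbol} {p x₁ x₂ : Port} (l : Letter) (u : InfPair) (h : .bin α p x₁ x₂ ∈ C) :
      Pass C (u, pick x₁ x₂ l) (pushLetter l α u, p) [.up p]

/-- A token jumps along a connection of a feedback. -/
def Jump (σ : Feedback) (x y : Pillar) (K : List Move) : Prop :=
  x.2 ∈ σ.dom ∧ y.2 = σ x.2 ∧ y.1 = x.1 ∧ K = []

/-- The token starts at the port of `x`, with the words of `x`, and travels through the net until
it stops at `y` after following a wire. It is stuck at `ε` cells. -/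
def PreNet.Run (μ : PreNet) : Pillar → Pillar → List Move → Prop :=
  Alt (Wire μ.wires) (Pass μ.cells)

theorem Wire.symm {W : Finset (Sym2 Port)} {x y : Pillar} {K : List Move} (h : Wire W x y K) :
    Wire W y x K := ⟨Sym2.eq_swap ▸ h.1, h.2.1.symm, h.2.2⟩

theorem Wire.mono {W W' : Finset (Sym2 Port)} (h : W ⊆ W') : Wire W ≤ Wire W' :=
  fun _ _ _ hw => ⟨h hw.1, hw.2⟩

theorem wire_union {W W' : Finset (Sym2 Port)} : Wire (W ∪ W') = Wire W ⊔ Wire W' := by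
  ext x y K
  simp only [Wire, Finset.mem_union, Pi.sup_apply, sup_Prop_eq]
  tauto

theorem Pass.exists_symm {C : Finset Cell} {x y : Pillar} {K : List Move} (h : Pass C x y K) :
    ∃ K', Pass C y x K' := by
  cases h with
  | down l u h => exact ⟨_, .up l u h⟩
  | up l u h => exact ⟨_, .down l u h⟩

/-- Only the binary cells matter to tokens. -/
theorem Pass.mono {C C' : Finset Cell}
    (h : ∀ α p x₁ x₂, .bin α p x₁ x₂ ∈ C → .bin α p x₁ x₂ ∈ C') : Pass C ≤ Pass C' := by
  rintro x y K (⟨l, u, hc⟩ | ⟨l, u, hc⟩)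
  exacts [.down l u (h _ _ _ _ hc), .up l u (h _ _ _ _ hc)]

theorem pass_union {C C' : Finset Cell} : Pass (C ∪ C') = Pass C ⊔ Pass C' := by
  apply le_antisymm
  · rintro x y K (⟨l, u, hc⟩ | ⟨l, u, hc⟩) <;> rcases Finset.mem_union.1 hc with hc | hc
    exacts [.inl (.down l u hc), .inr (.down l u hc), .inl (.up l u hc), .inr (.up l u hc)]
  · exact sup_le (Pass.mono fun _ _ _ _ h => Finset.mem_union_left _ h)
      (Pass.mono fun _ _ _ _ h => Finset.mem_union_right _ h)

theorem mem_ports_bin {α : BinSymbol} {p x₁ x₂ r : Port} :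
    r ∈ (Cell.bin α p x₁ x₂).ports ↔ r = p ∨ r = x₁ ∨ r = x₂ := by
  simp [Cell.ports]

theorem mem_ports_eps {p r : Port} : r ∈ (Cell.eps p).ports ↔ r = p := by
  simp [Cell.ports]

theorem pick_mem_ports {α : BinSymbol} {p x₁ x₂ : Port} (l : Letter) :
    pick x₁ x₂ l ∈ (Cell.bin α p x₁ x₂).ports := by
  cases l <;> simp [Cell.ports, pick]

theorem principal_mem_ports (c : Cell) : c.principal ∈ c.ports := by
  cases c <;> simp [Cell.ports, Cell.principal]

theorem Pass.left_mem {C : Finset Cell} {x y : Pillar} {K : List Move} (h : Pass C x y K) :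
    ∃ c ∈ C, x.2 ∈ c.ports := by
  cases h with
  | down l u h => exact ⟨_, h, principal_mem_ports _⟩
  | up l u h => exact ⟨_, h, pick_mem_ports l⟩

theorem Pass.right_mem {C : Finset Cell} {x y : Pillar} {K : List Move} (h : Pass C x y K) :
    ∃ c ∈ C, y.2 ∈ c.ports :=
  h.exists_symm.elim fun _ => Pass.left_mem

theorem PreNet.Run.exists_symm {μ : PreNet} {x y : Pillar} {L : List Move} (h : μ.Run x y L) :
    ∃ L', μ.Run y x L' :=
  Alt.exists_symm (fun _ _ _ h => ⟨_, h.symm⟩) (fun _ _ _ h => h.exists_symm) h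

theorem PreNet.Run.exists_mem_cells {μ : PreNet} {x y : Pillar} {L : List Move}
    (h : μ.Run x y L) {p : Port} (hp : .up p ∈ L) :
    ∃ α x₁ x₂, .bin α p x₁ x₂ ∈ μ.cells := by
  refine Alt.forall_label (p := fun m => ∀ p, m = .up p → ∃ α x₁ x₂, .bin α p x₁ x₂ ∈ μ.cells)
    ?_ ?_ h _ hp p rfl
  · rintro _ _ _ ⟨-, -, rfl⟩
    simp
  · rintro _ _ _ (⟨l, u, hc⟩ | ⟨l, u, hc⟩) <;> simp only [List.mem_singleton]
    · rintro _ rfl _ ⟨⟩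
    · rintro _ rfl _ ⟨⟩
      exact ⟨_, _, _, hc⟩

/-! ### Ports, cells and wires of a net -/

namespace PreNet

theorem cellOcc_pos {C : Finset Cell} {c : Cell} {r : Port} (hc : c ∈ C) (hr : r ∈ c.ports) :
    0 < ∑ c ∈ C, c.ports.count r :=
  (Multiset.count_pos.2 hr).trans_le
    (Finset.single_le_sum (f := fun c : Cell => c.ports.count r) (fun _ _ => Nat.zero_le _) hc)

theorem cellOcc_eq_zero {C : Finset Cell} {r : Port} :
    ∑ c ∈ C, c.ports.count r = 0 ↔ ∀ c ∈ C, r ∉ c.ports := by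
  simp [Finset.sum_eq_zero_iff, Multiset.count_eq_zero]

theorem occ_pos_of_cell {μ : PreNet} {c : Cell} {r : Port} (hc : c ∈ μ.cells)
    (hr : r ∈ c.ports) : 0 < μ.occ r := (cellOcc_pos hc hr).trans_le (Nat.le_add_right _ _)

namespace IsNet

variable {μ : PreNet} (h : μ.IsNet)
include h

theorem cellOcc_le_one (r : Port) : ∑ c ∈ μ.cells, c.ports.count r ≤ 1 := by
  rcases Nat.eq_zero_or_pos (μ.occ r) with h0 | h0
  · have : ∑ c ∈ μ.cells, c.ports.count r ≤ μ.occ r := Nat.le_add_right _ _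
    omega
  · obtain ⟨a, ha⟩ := h.exists_wire h0
    have h1 := h.occ_eq ha
    have h2 := h.occ_le_two r
    split_ifs at h1 <;> omega

theorem wired {c : Cell} {r : Port} (hc : c ∈ μ.cells) (hr : r ∈ c.ports) :
    ∃ b, b ≠ r ∧ s(r, b) ∈ μ.wires := by
  obtain ⟨a, ha⟩ := h.exists_wire (occ_pos_of_cell hc hr)
  refine ⟨a, fun e => ?_, ha⟩
  have h1 := h.occ_eq ha
  have h2 := h.occ_le_two r
  have h3 := cellOcc_pos hc hr
  rw [if_pos e] at h1
  omega

theorem cell_unique {c c' : Cell} {r : Port} (hc : c ∈ μ.cells) (hc' : c' ∈ μ.cells)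
    (hr : r ∈ c.ports) (hr' : r ∈ c'.ports) : c = c' := by
  by_contra hne
  have h1 : ∑ c ∈ {c, c'}, c.ports.count r ≤ ∑ c ∈ μ.cells, c.ports.count r :=
    Finset.sum_le_sum_of_subset (by simp [Finset.insert_subset_iff, hc, hc'])
  rw [Finset.sum_pair hne] at h1
  have h2 := Multiset.count_pos.2 hr
  have h3 := Multiset.count_pos.2 hr'
  have h4 := h.cellOcc_le_one r
  omega

theorem ports_nodup {c : Cell} (hc : c ∈ μ.cells) : c.ports.Nodup :=
  Multiset.nodup_iff_count_le_one.2 fun r => (Finset.single_le_sum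
    (f := fun c : Cell => c.ports.count r) (fun _ _ => Nat.zero_le _) hc).trans
      (h.cellOcc_le_one r)

theorem mem_interface_iff {i : Port} :
    i ∈ μ.interface ↔ (∃ b, b ≠ i ∧ s(i, b) ∈ μ.wires) ∧ ∀ c ∈ μ.cells, i ∉ c.ports := by
  rw [interface, Set.mem_ofPred_eq, ← cellOcc_eq_zero]
  constructor
  · intro hi
    obtain ⟨b, hb⟩ := h.exists_wire (p := i) (by omega)
    have := h.occ_eq hb
    split_ifs at this
    · omega
    · exact ⟨⟨b, ‹_›, hb⟩, by omega⟩
  · rintro ⟨⟨b, hne, hb⟩, h0⟩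
    rw [h.occ_eq hb, h0, if_neg hne]

end IsNet

theorem occ_eq_zero_iff {μ : PreNet} {r : Port} :
    μ.occ r = 0 ↔ (∀ c ∈ μ.cells, r ∉ c.ports) ∧ ∀ b, s(r, b) ∉ μ.wires := by
  rw [occ, Nat.add_eq_zero_iff, cellOcc_eq_zero, Finset.sum_eq_zero_iff]
  simp only [Multiset.count_eq_zero, Sym2.mem_toMultiset]
  refine and_congr_right fun _ => ⟨fun h b hb => h _ hb (Sym2.mem_mk_left _ _), ?_⟩
  rintro h w hw ⟨b, rfl⟩
  exact h b hw

theorem isNet_of {μ : PreNet}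
    (wire_unique : ∀ r a b, s(r, a) ∈ μ.wires → s(r, b) ∈ μ.wires → a = b)
    (cell_unique : ∀ c ∈ μ.cells, ∀ c' ∈ μ.cells, ∀ r ∈ c.ports, r ∈ c'.ports → c = c')
    (ports_nodup : ∀ c ∈ μ.cells, c.ports.Nodup)
    (wired : ∀ c ∈ μ.cells, ∀ r ∈ c.ports, ∃ b, b ≠ r ∧ s(r, b) ∈ μ.wires) : μ.IsNet := by
  have hcell : ∀ r, ∑ c ∈ μ.cells, c.ports.count r ≤ 1 := by
    intro r
    by_cases h0 : ∀ c ∈ μ.cells, r ∉ c.ports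
    · rw [cellOcc_eq_zero.2 h0]
      omega
    · push Not at h0
      obtain ⟨c, hc, hr⟩ := h0
      rw [Finset.sum_eq_single_of_mem c hc]
      · exact Multiset.nodup_iff_count_le_one.1 (ports_nodup c hc) r
      · intro c' hc' hne
        exact Multiset.count_eq_zero.2 fun hr' => hne (cell_unique c' hc' c hc r hr' hr)
  have key : ∀ r, μ.occ r = 0 ∨ ∃ a, s(r, a) ∈ μ.wires := by
    intro r
    by_contra! hcon
    refine hcon.1 (occ_eq_zero_iff.2 ⟨fun c hc hr => ?_, hcon.2⟩)
    obtain ⟨b, -, hb⟩ := wired c hc r hr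
    exact hcon.2 b hb
  have huniq : ∀ r a, s(r, a) ∈ μ.wires → ∀ w ∈ μ.wires, r ∈ w → w = s(r, a) := by
    rintro r a ha w hw ⟨b, rfl⟩
    rw [wire_unique r a b ha hw]
  constructor
  · intro r
    rcases key r with h0 | ⟨a, ha⟩
    · omega
    · rw [occ, wireOcc_eq ha (huniq r a ha)]
      have := hcell r
      split_ifs with har
      · rw [cellOcc_eq_zero.2 fun c hc hr => ?_]
        obtain ⟨b, hne, hb⟩ := wired c hc r hr
        exact hne (wire_unique r b a hb ha ▸ har)
      · omega
  · intro r h0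
    rcases key r with h0' | ⟨a, ha⟩
    · omega
    · exact ⟨_, ⟨ha, Sym2.mem_mk_left _ _⟩, fun w hw => huniq r a ha w hw.1 hw.2⟩

end PreNet

/-! ### Hiding a part of a net -/

/-- The passage of a token through a part of a net made of the cells `C` and the wires `W`, from
the outside to the outside: one cell, one wire, one cell. -/
def Bridge (C : Finset Cell) (W : Finset (Sym2 Port)) (x y : Pillar) (K : List Move) : Prop :=
  ∃ b b' K₁ K₂, Pass C x b K₁ ∧ Wire W b b' [] ∧ Pass C b' y K₂ ∧ K = K₁ ++ K₂

/-- The ports in `H` are those of the wires `W₂`, and each cell of `C₂` separates `H` from its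
complement. Then the runs between ports outside `H` see `C₂` and `W₂` as bridges only. -/
theorem alt_union_iff_bridge {C₁ C₂ : Finset Cell} {W₁ W₂ : Finset (Sym2 Port)} (H : Set Port)
    (hW₁ : ∀ a b, s(a, b) ∈ W₁ → a ∉ H) (hC₁ : ∀ c ∈ C₁, ∀ r ∈ c.ports, r ∉ H)
    (hW₂ : ∀ a b, s(a, b) ∈ W₂ → a ∈ H)
    (hC₂ : ∀ x y K, Pass C₂ x y K → (x.2 ∈ H ↔ y.2 ∉ H))
    {x y : Pillar} {L : List Move} (hx : x.2 ∉ H) (hy : y.2 ∉ H) :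
    Alt (Wire (W₁ ∪ W₂)) (Pass (C₁ ∪ C₂)) x y L ↔
      Alt (Wire W₁) (Pass C₁ ⊔ Bridge C₂ W₂) x y L := by
  have hout : ∀ {a b K}, Wire (W₁ ∪ W₂) a b K → a.2 ∉ H → Wire W₁ a b K ∧ b.2 ∉ H := by
    rintro a b K ⟨hw, h⟩ ha
    rcases Finset.mem_union.1 hw with hw | hw
    · exact ⟨⟨hw, h⟩, hW₁ _ a.2 (Sym2.eq_swap ▸ hw)⟩
    · exact (ha (hW₂ _ _ hw)).elim
  have hin : ∀ {a b K}, Wire (W₁ ∪ W₂) a b K → a.2 ∈ H →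
      Wire W₂ a b [] ∧ b.2 ∈ H ∧ K = [] := by
    rintro a b K ⟨hw, h, rfl⟩ ha
    rcases Finset.mem_union.1 hw with hw | hw
    · exact (hW₁ _ _ hw ha).elim
    · exact ⟨⟨hw, h, rfl⟩, hW₂ _ a.2 (Sym2.eq_swap ▸ hw), rfl⟩
  constructor
  · intro h
    have key : (x.2 ∉ H → Alt (Wire W₁) (Pass C₁ ⊔ Bridge C₂ W₂) x y L) ∧
        (x.2 ∈ H → ∃ b z K L', Wire W₂ x b [] ∧ Pass C₂ b z K ∧ L = K ++ L' ∧
          Alt (Wire W₁) (Pass C₁ ⊔ Bridge C₂ W₂) z y L') := by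
      clear hx
      induction h with
      | base h =>
        exact ⟨fun hx => .base (hout h hx).1, fun hx => (hy (hin h hx).2.1).elim⟩
      | @cons x b z y K K' L h₁ h₂ _ ih =>
        obtain ⟨ih₁, ih₂⟩ := ih hy
        rw [pass_union] at h₂
        constructor
        · intro hx
          obtain ⟨h₁, hb⟩ := hout h₁ hx
          rcases h₂ with h₂ | h₂
          · obtain ⟨c, hc, hz⟩ := h₂.right_mem
            exact .cons h₁ (.inl h₂) (ih₁ (hC₁ c hc _ hz))
          · have hz : z.2 ∈ H := by_contra fun hz => hb ((hC₂ _ _ _ h₂).2 hz)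
            obtain ⟨b', z', K'', L', h₃, h₄, rfl, h₅⟩ := ih₂ hz
            have := Alt.cons h₁ (B := Pass C₁ ⊔ Bridge C₂ W₂)
              (.inr ⟨z, b', K', K'', h₂, h₃, h₄, rfl⟩) h₅
            simpa using this
        · intro hx
          obtain ⟨hxb, hb, rfl⟩ := hin h₁ hx
          rcases h₂ with h₂ | h₂
          · obtain ⟨c, hc, hb'⟩ := h₂.left_mem
            exact (hC₁ c hc _ hb' hb).elim
          · exact ⟨b, z, K', L, hxb, h₂, rfl, ih₁ ((hC₂ _ _ _ h₂).1 hb)⟩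
    exact key.1 hx
  · intro h
    clear hx hy
    rw [pass_union, wire_union]
    induction h with
    | base h => exact .base (.inl h)
    | cons h₁ h₂ _ ih =>
      rcases h₂ with h₂ | ⟨b, b', K₁, K₂, h₂, h₃, h₄, rfl⟩
      · exact .cons (.inl h₁) (.inl h₂) ih
      · simpa using Alt.cons (A := Wire W₁ ⊔ Wire W₂) (B := Pass C₁ ⊔ Pass C₂) (.inl h₁)
          (.inr h₂) (.cons (.inr h₃) (.inr h₄) ih)

/-! ### Active pairs of binary cells -/

theorem pick_apply {X : Type*} (x : Letter → X) (l : Letter) : pick (x .p) (x .q) l = x l := by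
  cases l <;> rfl

theorem mem_ports_bin_fun {α : BinSymbol} {p r : Port} {x : Letter → Port} :
    r ∈ (Cell.bin α p (x .p) (x .q)).ports ↔ r = p ∨ ∃ i, r = x i := by
  rw [mem_ports_bin]
  constructor
  · rintro (h | h | h)
    exacts [.inl h, .inr ⟨_, h⟩, .inr ⟨_, h⟩]
  · rintro (h | ⟨i, h⟩)
    · exact .inl h
    · cases i <;> simp [h]

theorem PreNet.IsNet.aux_ne {μ : PreNet} (h : μ.IsNet) {α : BinSymbol} {p : Port}
    {x : Letter → Port} (hc : .bin α p (x .p) (x .q) ∈ μ.cells) (i : Letter) : x i ≠ p := by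
  have := h.ports_nodup hc
  simp only [Cell.ports, Multiset.insert_eq_cons, Multiset.nodup_cons, Multiset.mem_cons,
    Multiset.mem_singleton, not_or] at this
  cases i
  exacts [this.1.1 ∘ Eq.symm, this.1.2 ∘ Eq.symm]

theorem PreNet.IsNet.aux_inj {μ : PreNet} (h : μ.IsNet) {α : BinSymbol} {p : Port}
    {x : Letter → Port} (hc : .bin α p (x .p) (x .q) ∈ μ.cells) {i j : Letter}
    (hij : x i = x j) : i = j := by
  have := h.ports_nodup hc
  simp only [Cell.ports, Multiset.insert_eq_cons, Multiset.nodup_cons, Multiset.mem_cons,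
    Multiset.mem_singleton, not_or] at this
  cases i <;> cases j <;> first | rfl | exact (this.2.1 hij).elim | exact (this.2.1 hij.symm).elim

section Pass

variable {μ : PreNet} (h : μ.IsNet) {α : BinSymbol} {p : Port} {x : Letter → Port}
  (hc : .bin α p (x .p) (x .q) ∈ μ.cells) {a b : Pillar} {K : List Move}
include h hc

theorem Pass.eq_of_right_principal (hp : Pass μ.cells a b K) (hb : b.2 = p) :
    ∃ l u, a = (u, x l) ∧ b = (pushLetter l α u, p) ∧ K = [.up p] := by
  cases hp with
  | down l u hc' =>
    cases h.cell_unique hc hc' (mem_ports_bin_fun.2 (.inl rfl)) (hb ▸ pick_mem_ports l)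
    exact (h.aux_ne hc l ((pick_apply x l).symm.trans hb)).elim
  | up l u hc' =>
    obtain rfl := hb
    cases h.cell_unique hc hc' (mem_ports_bin_fun.2 (.inl rfl)) (mem_ports_bin.2 (.inl rfl))
    exact ⟨l, u, by rw [pick_apply], rfl, rfl⟩

theorem Pass.eq_of_right_aux (hp : Pass μ.cells a b K) {i : Letter} (hb : b.2 = x i) :
    ∃ u, a = (pushLetter i α u, p) ∧ b = (u, x i) ∧ K = [.down p] := by
  cases hp with
  | down l u hc' =>
    cases h.cell_unique hc hc' (mem_ports_bin_fun.2 (.inr ⟨i, rfl⟩)) (hb ▸ pick_mem_ports l)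
    rw [pick_apply] at hb ⊢
    obtain rfl := h.aux_inj hc hb
    exact ⟨u, rfl, rfl, rfl⟩
  | up l u hc' =>
    cases h.cell_unique hc hc' (mem_ports_bin_fun.2 (.inr ⟨i, rfl⟩))
      (mem_ports_bin.2 (.inl hb.symm))
    exact (h.aux_ne hc i hb.symm).elim

theorem Pass.eq_of_left_principal (hp : Pass μ.cells a b K) (ha : a.2 = p) :
    ∃ l u, a = (pushLetter l α u, p) ∧ b = (u, x l) ∧ K = [.down p] := by
  cases hp with
  | up l u hc' =>
    cases h.cell_unique hc hc' (mem_ports_bin_fun.2 (.inl rfl)) (ha ▸ pick_mem_ports l)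
    exact (h.aux_ne hc l ((pick_apply x l).symm.trans ha)).elim
  | down l u hc' =>
    obtain rfl := ha
    cases h.cell_unique hc hc' (mem_ports_bin_fun.2 (.inl rfl)) (mem_ports_bin.2 (.inl rfl))
    exact ⟨l, u, rfl, by rw [pick_apply], rfl⟩

theorem Pass.eq_of_left_aux (hp : Pass μ.cells a b K) {i : Letter} (ha : a.2 = x i) :
    ∃ u, a = (u, x i) ∧ b = (pushLetter i α u, p) ∧ K = [.up p] := by
  cases hp with
  | up l u hc' =>
    cases h.cell_unique hc hc' (mem_ports_bin_fun.2 (.inr ⟨i, rfl⟩)) (ha ▸ pick_mem_ports l)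
    rw [pick_apply] at ha ⊢
    obtain rfl := h.aux_inj hc ha
    exact ⟨u, rfl, rfl, rfl⟩
  | down l u hc' =>
    cases h.cell_unique hc hc' (mem_ports_bin_fun.2 (.inr ⟨i, rfl⟩))
      (mem_ports_bin.2 (.inl ha.symm))
    exact (h.aux_ne hc i ha.symm).elim

end Pass

theorem Pass.down_fun {C : Finset Cell} {α : BinSymbol} {p : Port} {x : Letter → Port}
    (hc : .bin α p (x .p) (x .q) ∈ C) (l : Letter) (u : InfPair) :
    Pass C (pushLetter l α u, p) (u, x l) [.down p] := by
  simpa only [pick_apply] using Pass.down l u hc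

theorem Pass.up_fun {C : Finset Cell} {α : BinSymbol} {p : Port} {x : Letter → Port}
    (hc : .bin α p (x .p) (x .q) ∈ C) (l : Letter) (u : InfPair) :
    Pass C (u, x l) (pushLetter l α u, p) [.up p] := by
  simpa only [pick_apply] using Pass.up l u hc

/-- An active pair of binary cells of the net `μ`. The auxiliary ports are indexed by the letters
that they stand for. -/
structure ActivePair (μ : PreNet) (α : BinSymbol) (p : Port) (x : Letter → Port) (β : BinSymbol)
    (q : Port) (y : Letter → Port) : Prop where
  net : μ.IsNet
  fst : .bin α p (x .p) (x .q) ∈ μ.cells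
  snd : .bin β q (y .p) (y .q) ∈ μ.cells
  wire : s(p, q) ∈ μ.wires

/-- What remains of a net when an active pair is erased. -/
def PreNet.erasePair (μ : PreNet) (α : BinSymbol) (p : Port) (x : Letter → Port) (β : BinSymbol)
    (q : Port) (y : Letter → Port) : PreNet where
  cells := μ.cells \ {.bin α p (x .p) (x .q), .bin β q (y .p) (y .q)}
  wires := μ.wires \ {s(p, q)}

namespace PreNet

variable {μ : PreNet} {α β : BinSymbol} {p q : Port} {x y : Letter → Port} {c : Cell}

theorem mem_of_mem_erasePair (hc : c ∈ (μ.erasePair α p x β q y).cells) : c ∈ μ.cells :=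
  (Finset.mem_sdiff.1 hc).1

theorem mem_erasePair_or (hc : c ∈ μ.cells) :
    c ∈ (μ.erasePair α p x β q y).cells ∨ c = .bin α p (x .p) (x .q) ∨
      c = .bin β q (y .p) (y .q) := by
  simp only [erasePair, Finset.mem_sdiff, Finset.mem_insert, Finset.mem_singleton]
  tauto

end PreNet

/-- A token enters one cell of an active pair through the auxiliary port `x i` and leaves the
other one through the auxiliary port `y j`. -/
def Crossing (α β : BinSymbol) (x y : Letter → Port) (M : Letter → Letter → List Move)
    (a b : Pillar) (K : List Move) : Prop :=
  ∃ i j u v, pushLetter i α u = pushLetter j β v ∧ a = (u, x i) ∧ b = (v, y j) ∧ K = M i j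

theorem Crossing.exists_map {α β : BinSymbol} {x y : Letter → Port}
    {M M' : Letter → Letter → List Move} {s t : Pillar} {K : List Move}
    (h : Crossing α β x y M s t K) : ∃ K', Crossing α β x y M' s t K' := by
  obtain ⟨i, j, u, v, h, hs, ht, -⟩ := h
  exact ⟨_, i, j, u, v, h, hs, ht, rfl⟩

theorem Crossing.exists_weight_lt {α β : BinSymbol} {x y : Letter → Port}
    {M M' : Letter → Letter → List Move} {s t : Pillar} {K : List Move}
    (hM : ∀ i j n, weight (M' i j) n < weight (M i j) n)
    (h : Crossing α β x y M s t K) :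
    ∃ K', Crossing α β x y M' s t K' ∧ ∀ n, weight K' n < weight K n := by
  obtain ⟨i, j, u, v, h, hs, ht, rfl⟩ := h
  exact ⟨_, ⟨i, j, u, v, h, hs, ht, rfl⟩, hM i j⟩

namespace ActivePair

variable {μ : PreNet} {α β : BinSymbol} {p q : Port} {x y : Letter → Port}
  (P : ActivePair μ α p x β q y)
include P

theorem symm : ActivePair μ β q y α p x := ⟨P.net, P.snd, P.fst, Sym2.eq_swap ▸ P.wire⟩

theorem ne : p ≠ q := by
  rintro rfl
  obtain ⟨b, hb, hw⟩ := P.net.wired P.fst (mem_ports_bin.2 (.inl rfl))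
  exact hb (P.net.wire_unique hw P.wire)

theorem disjoint {r : Port} (h : r ∈ (Cell.bin α p (x .p) (x .q)).ports)
    (h' : r ∈ (Cell.bin β q (y .p) (y .q)).ports) : False := by
  have := P.net.cell_unique P.fst P.snd h h'
  injection this with _ h
  exact P.ne h

theorem x_ne_p (i : Letter) : x i ≠ p := P.net.aux_ne P.fst i

theorem x_ne_q (i : Letter) : x i ≠ q := fun h =>
  P.disjoint (mem_ports_bin_fun.2 (.inr ⟨i, h.symm⟩)) (mem_ports_bin_fun.2 (.inl rfl))

theorem x_ne_y (i j : Letter) : x i ≠ y j := fun h =>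
  P.disjoint (mem_ports_bin_fun.2 (.inr ⟨i, rfl⟩)) (mem_ports_bin_fun.2 (.inr ⟨j, h⟩))

theorem x_inj {i j : Letter} (h : x i = x j) : i = j := P.net.aux_inj P.fst h

theorem fst_notMem {c : Cell} (hc : c ∈ (μ.erasePair α p x β q y).cells) {r : Port}
    (hr : r ∈ c.ports) : r ∉ (Cell.bin α p (x .p) (x .q)).ports := by
  simp only [PreNet.erasePair, Finset.mem_sdiff, Finset.mem_insert, Finset.mem_singleton,
    not_or] at hc
  exact fun h => hc.2.1 (P.net.cell_unique hc.1 P.fst hr h)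

theorem snd_notMem {c : Cell} (hc : c ∈ (μ.erasePair α p x β q y).cells) {r : Port}
    (hr : r ∈ c.ports) : r ∉ (Cell.bin β q (y .p) (y .q)).ports := by
  simp only [PreNet.erasePair, Finset.mem_sdiff, Finset.mem_insert, Finset.mem_singleton,
    not_or] at hc
  exact fun h => hc.2.2 (P.net.cell_unique hc.1 P.snd hr h)

theorem mem_wires_iff {a b : Port} :
    s(a, b) ∈ (μ.erasePair α p x β q y).wires ↔ s(a, b) ∈ μ.wires ∧ a ≠ p ∧ a ≠ q := by
  simp only [PreNet.erasePair, Finset.mem_sdiff, Finset.mem_singleton]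
  refine and_congr_right fun hw => ⟨fun h => ⟨?_, ?_⟩, ?_⟩
  · rintro rfl
    exact h (by rw [P.net.wire_unique hw P.wire])
  · rintro rfl
    exact h (by rw [P.net.wire_unique hw P.symm.wire, Sym2.eq_swap])
  · rintro ⟨h₁, h₂⟩ h
    rcases Sym2.mem_iff.1 (h ▸ Sym2.mem_mk_left a b) with rfl | rfl
    exacts [h₁ rfl, h₂ rfl]

theorem isNet_erasePair : (μ.erasePair α p x β q y).IsNet := by
  refine PreNet.isNet_of ?_ ?_ ?_ ?_
  · intro r a b ha hb
    exact P.net.wire_unique (P.mem_wires_iff.1 ha).1 (P.mem_wires_iff.1 hb).1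
  · intro c hc c' hc' r
    exact P.net.cell_unique (PreNet.mem_of_mem_erasePair hc) (PreNet.mem_of_mem_erasePair hc')
  · intro c hc
    exact P.net.ports_nodup (PreNet.mem_of_mem_erasePair hc)
  · intro c hc r hr
    obtain ⟨b, hb, hw⟩ := P.net.wired (PreNet.mem_of_mem_erasePair hc) hr
    refine ⟨b, hb, P.mem_wires_iff.2 ⟨hw, ?_, ?_⟩⟩
    · rintro rfl
      exact P.fst_notMem hc hr (mem_ports_bin.2 (.inl rfl))
    · rintro rfl
      exact P.snd_notMem hc hr (mem_ports_bin.2 (.inl rfl))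

theorem ne_of_mem_interface {i : Port} (hi : i ∈ μ.interface) : i ≠ p ∧ i ≠ q := by
  rw [P.net.mem_interface_iff] at hi
  exact ⟨fun h => hi.2 _ P.fst (mem_ports_bin.2 (.inl h)),
    fun h => hi.2 _ P.snd (mem_ports_bin.2 (.inl h))⟩

theorem x_mem_interface (i : Letter) : x i ∈ (μ.erasePair α p x β q y).interface := by
  have hi : x i ∈ (Cell.bin α p (x .p) (x .q)).ports := mem_ports_bin_fun.2 (.inr ⟨i, rfl⟩)
  obtain ⟨b, hb, hw⟩ := P.net.wired P.fst hi
  exact P.isNet_erasePair.mem_interface_iff.2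
    ⟨⟨b, hb, P.mem_wires_iff.2 ⟨hw, P.x_ne_p i, P.x_ne_q i⟩⟩, fun c hc h => P.fst_notMem hc h hi⟩

theorem y_mem_interface (i : Letter) : y i ∈ (μ.erasePair α p x β q y).interface := by
  have hi : y i ∈ (Cell.bin β q (y .p) (y .q)).ports := mem_ports_bin_fun.2 (.inr ⟨i, rfl⟩)
  obtain ⟨b, hb, hw⟩ := P.net.wired P.snd hi
  exact P.isNet_erasePair.mem_interface_iff.2
    ⟨⟨b, hb, P.mem_wires_iff.2 ⟨hw, P.symm.x_ne_q i, P.symm.x_ne_p i⟩⟩,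
      fun c hc h => P.snd_notMem hc h hi⟩

theorem mem_interface_erasePair_iff {r : Port} :
    r ∈ (μ.erasePair α p x β q y).interface ↔
      r ∈ μ.interface ∨ (∃ i, r = x i) ∨ ∃ i, r = y i := by
  constructor
  · intro h
    obtain ⟨⟨b, hb, hw⟩, hr⟩ := P.isNet_erasePair.mem_interface_iff.1 h
    obtain ⟨hw, hp, hq⟩ := P.mem_wires_iff.1 hw
    by_contra! hcon
    refine hcon.1 (P.net.mem_interface_iff.2 ⟨⟨b, hb, hw⟩, fun c hc hrc => ?_⟩)
    rcases PreNet.mem_erasePair_or (α := α) (p := p) (x := x) (β := β) (q := q) (y := y) hc with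
      hc | rfl | rfl
    · exact hr c hc hrc
    · rcases mem_ports_bin_fun.1 hrc with h | ⟨i, h⟩
      exacts [hp h, hcon.2.1 i h]
    · rcases mem_ports_bin_fun.1 hrc with h | ⟨i, h⟩
      exacts [hq h, hcon.2.2 i h]
  · rintro (h | ⟨i, rfl⟩ | ⟨i, rfl⟩)
    · obtain ⟨⟨b, hb, hw⟩, hr⟩ := P.net.mem_interface_iff.1 h
      exact P.isNet_erasePair.mem_interface_iff.2
        ⟨⟨b, hb, P.mem_wires_iff.2 ⟨hw, P.ne_of_mem_interface h⟩⟩,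
          fun c hc => hr c (PreNet.mem_of_mem_erasePair hc)⟩
    · exact P.x_mem_interface i
    · exact P.y_mem_interface i

theorem bridge_iff {a b : Pillar} {K : List Move} :
    Bridge {.bin α p (x .p) (x .q), .bin β q (y .p) (y .q)} {s(p, q)} a b K ↔
      (Crossing α β x y (fun _ _ => [.up p, .down q]) ⊔
        Crossing β α y x (fun _ _ => [.up q, .down p])) a b K := by
  have hsub : Pass {.bin α p (x .p) (x .q), .bin β q (y .p) (y .q)} ≤ Pass μ.cells :=
    Pass.mono fun _ _ _ _ h => by
      rcases Finset.mem_insert.1 h with h | h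
      exacts [h ▸ P.fst, Finset.mem_singleton.1 h ▸ P.snd]
  constructor
  · rintro ⟨c, c', K₁, K₂, h₁, ⟨hw, hu, -⟩, h₂, rfl⟩
    rcases Sym2.eq_iff.1 (Finset.mem_singleton.1 hw) with ⟨hp, hq⟩ | ⟨hq, hp⟩
    · obtain ⟨i, u, rfl, rfl, rfl⟩ := (hsub _ _ _ h₁).eq_of_right_principal P.net P.fst hp
      obtain ⟨j, v, rfl, rfl, rfl⟩ := (hsub _ _ _ h₂).eq_of_left_principal P.net P.snd hq
      exact .inl ⟨i, j, u, v, hu, rfl, rfl, rfl⟩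
    · obtain ⟨i, u, rfl, rfl, rfl⟩ := (hsub _ _ _ h₁).eq_of_right_principal P.net P.snd hq
      obtain ⟨j, v, rfl, rfl, rfl⟩ := (hsub _ _ _ h₂).eq_of_left_principal P.net P.fst hp
      exact .inr ⟨i, j, u, v, hu, rfl, rfl, rfl⟩
  · rintro (⟨i, j, u, v, hu, rfl, rfl, rfl⟩ | ⟨i, j, u, v, hu, rfl, rfl, rfl⟩)
    · exact ⟨_, _, _, _, .up_fun (by simp) i u, ⟨by simp, hu, rfl⟩, .down_fun (by simp) j v, rfl⟩
    · exact ⟨_, _, _, _, .up_fun (by simp) i u, ⟨by simp [Sym2.eq_swap], hu, rfl⟩,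
        .down_fun (by simp) j v, rfl⟩

/-- To a run between other ports than `p` and `q`, the active pair is a pair of crossings. -/
theorem run_iff {a b : Pillar} {L : List Move} (ha : a.2 ≠ p ∧ a.2 ≠ q) (hb : b.2 ≠ p ∧ b.2 ≠ q) :
    μ.Run a b L ↔
      Alt (Wire (μ.erasePair α p x β q y).wires) (Pass (μ.erasePair α p x β q y).cells ⊔
        (Crossing α β x y (fun _ _ => [.up p, .down q]) ⊔
          Crossing β α y x (fun _ _ => [.up q, .down p]))) a b L := by
  have hcells : μ.cells = (μ.erasePair α p x β q y).cells ∪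
      {.bin α p (x .p) (x .q), .bin β q (y .p) (y .q)} := by
    rw [PreNet.erasePair, Finset.sdiff_union_of_subset]
    simp [Finset.insert_subset_iff, P.fst, P.snd]
  have hwires : μ.wires = (μ.erasePair α p x β q y).wires ∪ {s(p, q)} := by
    rw [PreNet.erasePair, Finset.sdiff_union_of_subset]
    simp [P.wire]
  have hbr : Bridge {.bin α p (x .p) (x .q), .bin β q (y .p) (y .q)} {s(p, q)} =
      Crossing α β x y (fun _ _ => [.up p, .down q]) ⊔
        Crossing β α y x (fun _ _ => [.up q, .down p]) := by
    ext a b K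
    exact P.bridge_iff
  rw [PreNet.Run, hcells, hwires, alt_union_iff_bridge {p, q}, hbr]
  · intro a b h
    simpa using (P.mem_wires_iff.1 h).2
  · intro c hc r hr
    have h₁ := P.fst_notMem hc hr
    have h₂ := P.snd_notMem hc hr
    rw [mem_ports_bin_fun, not_or] at h₁ h₂
    simp [h₁.1, h₂.1]
  · intro a b h
    simpa using Sym2.mem_iff.1 (Finset.mem_singleton.1 h ▸ Sym2.mem_mk_left a b)
  · rintro a b K (⟨l, u, hc⟩ | ⟨l, u, hc⟩) <;>
      simp only [Finset.mem_insert, Finset.mem_singleton, Cell.bin.injEq] at hc <;>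
      rcases hc with ⟨rfl, rfl, rfl, rfl⟩ | ⟨rfl, rfl, rfl, rfl⟩ <;>
      simp [pick_apply, P.x_ne_p, P.x_ne_q, P.symm.x_ne_p, P.symm.x_ne_q]
  · simpa using ha
  · simpa using hb

end ActivePair

/-! ### Runs and feedbacks -/

namespace PreNet

theorem linked_iff_alt {μ : PreNet} {σ : Feedback} {a b : Port} (u : InfPair) :
    μ.Linked σ a b ↔ Alt (Wire μ.wires) (Jump σ) (u, a) (u, b) [] := by
  constructor
  · intro h
    induction h with
    | wire h => exact .base ⟨h, rfl, rfl⟩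
    | @step i b _ hi hw ih =>
      exact ih.trans (z := (u, σ i)) ⟨hi, rfl, rfl, rfl⟩ (.base ⟨hw, rfl, rfl⟩)
  · intro h
    obtain ⟨x, hx⟩ : ∃ x : Pillar, x = (u, a) := ⟨_, rfl⟩
    obtain ⟨y, hy⟩ : ∃ y : Pillar, y = (u, b) := ⟨_, rfl⟩
    rw [← hx, ← hy] at h
    generalize [] = L at h
    have ha : a = x.2 := by rw [hx]
    have hb : b = y.2 := by rw [hy]
    rw [ha, hb, linked_iff]
    clear hx hy ha hb
    induction h with
    | base h => exact ⟨_, h.1, .refl⟩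
    | cons h₁ h₂ _ ih =>
      obtain ⟨c, hc, hr⟩ := ih
      exact ⟨_, h₁.1, .head ⟨h₂.1, h₂.2.1 ▸ hc⟩ hr⟩

theorem alt_wire_jump {μ : PreNet} {σ : Feedback} {x y : Pillar} {K : List Move} :
    Alt (Wire μ.wires) (Jump σ) x y K ↔ μ.Linked σ x.2 y.2 ∧ x.1 = y.1 ∧ K = [] := by
  constructor
  · intro h
    have key : x.1 = y.1 ∧ K = [] := by
      induction h with
      | base h => exact h.2
      | cons h₁ h₂ _ ih =>
        obtain ⟨-, h₁, rfl⟩ := h₁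
        obtain ⟨-, -, h₂, rfl⟩ := h₂
        obtain ⟨h₃, rfl⟩ := ih
        exact ⟨h₁.trans (h₂.symm.trans h₃), rfl⟩
    obtain ⟨u, a⟩ := x
    obtain ⟨v, b⟩ := y
    obtain ⟨rfl, rfl⟩ := key
    exact ⟨(linked_iff_alt u).2 h, rfl, rfl⟩
  · obtain ⟨u, a⟩ := x
    obtain ⟨v, b⟩ := y
    rintro ⟨h, rfl, rfl⟩
    exact (linked_iff_alt u).1 h

theorem Linked.symm {μ : PreNet} {σ : Feedback} {a b : Port} (h : μ.Linked σ a b) :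
    μ.Linked σ b a := by
  let u : InfPair := (Stream'.const .p, Stream'.const .p)
  obtain ⟨L, h⟩ := Alt.exists_symm (fun _ _ _ h => ⟨_, Wire.symm h⟩)
    (fun x y K h => ⟨[], h.2.1 ▸ σ.mem_dom _ h.1, by rw [h.2.1, σ.invol _ h.1], h.2.2.1.symm, rfl⟩)
    ((linked_iff_alt u).1 h)
  exact (alt_wire_jump.1 h).1

/-- A token following a wire of `σ[μ]` follows a chain of wires of `μ` and jumps. -/
theorem wire_plug_iff {μ : PreNet} {σ : Feedback} {x y : Pillar} {K : List Move}
    (hx : x.2 ∉ σ.dom) :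
    Wire (μ.plug σ).wires x y K ↔ Alt (Wire μ.wires) (Jump σ) x y K ∧ y.2 ∉ σ.dom := by
  rw [alt_wire_jump, Wire, mem_plug_wires]
  constructor
  · rintro ⟨hw, h⟩
    generalize hs : s(x.2, y.2) = w at hw
    rcases hw with ⟨hl, ha, hb⟩ | ⟨hi, -, -⟩
    · rcases Sym2.eq_iff.1 hs with ⟨h₁, h₂⟩ | ⟨h₁, h₂⟩
      · rw [h₁, h₂]
        exact ⟨⟨hl, h⟩, hb⟩
      · rw [h₁, h₂]
        exact ⟨⟨hl.symm, h⟩, ha⟩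
    · rcases Sym2.mem_iff.1 (hs ▸ Sym2.mem_mk_left x.2 y.2) with h | h <;> exact (hx (h ▸ hi)).elim
  · rintro ⟨⟨hl, h⟩, hy⟩
    exact ⟨.chain hl hx hy, h⟩

/-- A run of `σ[μ]` is a run of `μ` in which the token may also jump along `σ`. -/
theorem run_plug_iff {μ : PreNet} {σ : Feedback} (hσ : ∀ c ∈ μ.cells, ∀ r ∈ c.ports, r ∉ σ.dom)
    {x y : Pillar} {L : List Move} (hx : x.2 ∉ σ.dom) :
    (μ.plug σ).Run x y L ↔
      Alt (Wire μ.wires) (Pass μ.cells ⊔ Jump σ) x y L ∧ y.2 ∉ σ.dom := by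
  rw [sup_comm, ← Alt.alt_alt]
  constructor
  · intro h
    induction h with
    | base h =>
      obtain ⟨h, hy⟩ := (wire_plug_iff hx).1 h
      exact ⟨.base h, hy⟩
    | cons h₁ h₂ _ ih =>
      obtain ⟨h₁, hy⟩ := (wire_plug_iff hx).1 h₁
      obtain ⟨c, hc, hz⟩ := Pass.right_mem h₂
      obtain ⟨ih, hy⟩ := ih (hσ c hc _ hz)
      exact ⟨.cons h₁ h₂ ih, hy⟩
  · rintro ⟨h, hy⟩
    induction h with
    | base h => exact .base ((wire_plug_iff hx).2 ⟨h, hy⟩)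
    | cons h₁ h₂ _ ih =>
      obtain ⟨c, hc, hz⟩ := h₂.right_mem
      obtain ⟨c', hc', hb⟩ := h₂.left_mem
      exact .cons ((wire_plug_iff hx).2 ⟨h₁, hσ c' hc' _ hb⟩) h₂ (ih (hσ c hc _ hz) hy)

theorem IsNet.notMem_dom {μ : PreNet} (h : μ.IsNet) {σ : Feedback} (hσ : ↑σ.dom ⊆ μ.interface) :
    ∀ c ∈ μ.cells, ∀ r ∈ c.ports, r ∉ σ.dom :=
  fun c hc _ hr hd => (h.mem_interface_iff.1 (hσ hd)).2 c hc hr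

theorem IsNet.mem_interface_plug_iff {μ : PreNet} (h : μ.IsNet) {σ : Feedback}
    (hσ : ↑σ.dom ⊆ μ.interface) {i : Port} :
    i ∈ (μ.plug σ).interface ↔ i ∈ μ.interface ∧ i ∉ σ.dom := by
  rw [(h.plug hσ).mem_interface_iff]
  constructor
  · rintro ⟨⟨b, hb, hw⟩, hc⟩
    have hi : i ∉ σ.dom := by
      intro hi
      rw [mem_plug_wires] at hw
      generalize hs : s(i, b) = w at hw
      rcases hw with ⟨hl, ha, hb⟩ | ⟨hi, -, -⟩
      · rcases Sym2.eq_iff.1 hs with ⟨rfl, rfl⟩ | ⟨rfl, rfl⟩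
        exacts [ha hi, hb hi]
      · rcases Sym2.eq_iff.1 hs with ⟨rfl, rfl⟩ | ⟨rfl, rfl⟩ <;> exact hb rfl
    obtain ⟨hl, -⟩ := (wire_plug_iff (x := ((Stream'.const .p, Stream'.const .p), i))
      (y := (_, b)) (K := []) hi).1 ⟨hw, rfl, rfl⟩
    obtain ⟨c, hic, hr⟩ := linked_iff.1 (alt_wire_jump.1 hl).1
    refine ⟨h.mem_interface_iff.2 ⟨⟨c, ?_, hic⟩, hc⟩, hi⟩
    rintro rfl
    rcases Relation.ReflTransGen.cases_head hr with rfl | ⟨z, hz, -⟩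
    exacts [hb rfl, hi hz.1]
  · rintro ⟨hi, hd⟩
    have hi' := h.mem_interface_iff.1 hi
    have h0 : 0 < μ.occ i := by
      have : μ.occ i = 1 := hi
      omega
    obtain ⟨b, hb, hl⟩ := h.exists_linked hσ hd h0
    refine ⟨⟨b, ?_, mem_plug_wires.2 (.chain hl hd hb)⟩, hi'.2⟩
    rintro rfl
    obtain ⟨c, hc, hr⟩ := linked_iff.1 hl
    rcases Relation.ReflTransGen.cases_tail hr with rfl | ⟨z, hz, hzi⟩
    · obtain ⟨⟨d, hd, hw⟩, -⟩ := hi'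
      exact hd (h.wire_unique hw hc)
    · -- The chain would come back along the wire on which it started.
      have hzc : σ z = c := h.wire_unique (Sym2.eq_swap ▸ hzi.2) hc
      exact h.not_turn hσ hz (hzc ▸ σ.mem_dom _ hzi.1) (by rw [← hzc, σ.invol _ hzi.1])

end PreNet

/-! ### Commutation of an active pair -/

/-- Two families of ports, pairwise distinct and fresh for `μ`. -/
structure IsFresh (μ : PreNet) (a b : Letter → Letter → Port) : Prop where
  fst : ∀ i j, μ.occ (a i j) = 0
  snd : ∀ i j, μ.occ (b i j) = 0
  fst_inj : ∀ {i j k l}, a i j = a k l → i = k ∧ j = l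
  snd_inj : ∀ {i j k l}, b i j = b k l → i = k ∧ j = l
  ne : ∀ i j k l, a i j ≠ b k l

theorem IsFresh.symm {μ : PreNet} {a b : Letter → Letter → Port} (h : IsFresh μ a b) :
    IsFresh μ b a :=
  ⟨h.snd, h.fst, h.snd_inj, h.fst_inj, fun i j k l e => h.ne k l i j e.symm⟩

theorem IsFresh.of_nodup {μ : PreNet} {a b : Letter → Letter → Port}
    (hnodup : [a .p .p, a .p .q, a .q .p, a .q .q, b .p .p, b .p .q, b .q .p, b .q .q].Nodup)
    (hfresh : ∀ r ∈ [a .p .p, a .p .q, a .q .p, a .q .q, b .p .p, b .p .q, b .q .p, b .q .q],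
      μ.occ r = 0) : IsFresh μ a b := by
  simp only [List.nodup_cons, List.mem_cons, List.not_mem_nil, or_false, not_or] at hnodup
  refine ⟨?_, ?_, ?_, ?_, ?_⟩
  · rintro (_ | _) (_ | _) <;> exact hfresh _ (by simp)
  · rintro (_ | _) (_ | _) <;> exact hfresh _ (by simp)
  · rintro (_ | _) (_ | _) (_ | _) (_ | _) h <;> grind
  · rintro (_ | _) (_ | _) (_ | _) (_ | _) h <;> grind
  · rintro (_ | _) (_ | _) (_ | _) (_ | _) <;> grind

theorem IsFresh.notMem_cell {μ : PreNet} {a b : Letter → Letter → Port} (F : IsFresh μ a b)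
    {c : Cell} (hc : c ∈ μ.cells)
    (i j : Letter) : a i j ∉ c.ports :=
  (PreNet.occ_eq_zero_iff.1 (F.fst i j)).1 c hc

theorem IsFresh.notMem_wire {μ : PreNet} {a b : Letter → Letter → Port} (F : IsFresh μ a b)
    (i j : Letter) (r : Port) :
    s(a i j, r) ∉ μ.wires :=
  (PreNet.occ_eq_zero_iff.1 (F.fst i j)).2 r

/-- The cells created by a commutation. -/
def commuteCells (α β : BinSymbol) (x y : Letter → Port) (a b : Letter → Letter → Port) :
    Finset Cell :=
  {.bin β (x .p) (a .p .p) (a .p .q), .bin β (x .q) (a .q .p) (a .q .q),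
    .bin α (y .p) (b .p .p) (b .p .q), .bin α (y .q) (b .q .p) (b .q .q)}

/-- The wires created by a commutation. -/
def commuteWires (a b : Letter → Letter → Port) : Finset (Sym2 Port) :=
  {s(a .p .p, b .p .p), s(a .p .q, b .q .p), s(a .q .p, b .p .q), s(a .q .q, b .q .q)}

theorem mem_commuteCells {α β : BinSymbol} {x y : Letter → Port} {a b : Letter → Letter → Port}
    {c : Cell} : c ∈ commuteCells α β x y a b ↔
      (∃ i, c = .bin β (x i) (a i .p) (a i .q)) ∨ ∃ i, c = .bin α (y i) (b i .p) (b i .q) := by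
  simp only [commuteCells, Finset.mem_insert, Finset.mem_singleton]
  constructor
  · rintro (h | h | h | h)
    exacts [.inl ⟨_, h⟩, .inl ⟨_, h⟩, .inr ⟨_, h⟩, .inr ⟨_, h⟩]
  · rintro (⟨_ | _, rfl⟩ | ⟨_ | _, rfl⟩) <;> simp

theorem mem_commuteWires {a b : Letter → Letter → Port} {r t : Port} :
    s(r, t) ∈ commuteWires a b ↔
      ∃ i j, (r = a i j ∧ t = b j i) ∨ (r = b j i ∧ t = a i j) := by
  simp only [commuteWires, Finset.mem_insert, Finset.mem_singleton, Sym2.eq_iff]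
  constructor
  · rintro (h | h | h | h)
    exacts [⟨_, _, h⟩, ⟨_, _, h⟩, ⟨_, _, h⟩, ⟨_, _, h⟩]
  · rintro ⟨_ | _, _ | _, h⟩ <;> simp [h]

/-- The result of commuting an active pair, with fresh ports `a`, `b`. -/
def PreNet.commute (μ : PreNet) (α : BinSymbol) (p : Port) (x : Letter → Port) (β : BinSymbol)
    (q : Port) (y : Letter → Port) (a b : Letter → Letter → Port) : PreNet where
  cells := (μ.erasePair α p x β q y).cells ∪ commuteCells α β x y a b
  wires := (μ.erasePair α p x β q y).wires ∪ commuteWires a b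

namespace ActivePair

variable {μ : PreNet} {α β : BinSymbol} {p q : Port} {x y : Letter → Port}
  {a b : Letter → Letter → Port} (P : ActivePair μ α p x β q y) (F : IsFresh μ a b)

include P F

theorem x_ne_a (i j k : Letter) : x i ≠ a j k := fun h =>
  F.notMem_cell P.fst j k (mem_ports_bin_fun.2 (.inr ⟨i, h.symm⟩))

theorem y_ne_a (i j k : Letter) : y i ≠ a j k := fun h =>
  F.notMem_cell P.snd j k (mem_ports_bin_fun.2 (.inr ⟨i, h.symm⟩))

theorem isNet_commute : (μ.commute α p x β q y a b).IsNet := by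
  have hnet := P.isNet_erasePair
  have hxa := P.x_ne_a F
  have hya := P.y_ne_a F
  have hxb := P.x_ne_a F.symm
  have hyb := P.y_ne_a F.symm
  have hab := F.ne
  have hxy := P.x_ne_y
  have hwire : ∀ {r t}, s(r, t) ∈ (μ.erasePair α p x β q y).wires →
      (∀ i j, r ≠ a i j) ∧ ∀ i j, r ≠ b i j := fun h =>
    ⟨fun i j e => F.notMem_wire i j _ (e ▸ (P.mem_wires_iff.1 h).1),
      fun i j e => F.symm.notMem_wire i j _ (e ▸ (P.mem_wires_iff.1 h).1)⟩
  have hcell : ∀ {c}, c ∈ (μ.erasePair α p x β q y).cells → ∀ r ∈ c.ports,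
      (∀ i j, r ≠ a i j) ∧ (∀ i j, r ≠ b i j) ∧ (∀ i, r ≠ x i) ∧ ∀ i, r ≠ y i := fun hc r hr =>
    ⟨fun i j e => F.notMem_cell (PreNet.mem_of_mem_erasePair hc) i j (e ▸ hr),
      fun i j e => F.symm.notMem_cell (PreNet.mem_of_mem_erasePair hc) i j (e ▸ hr),
      fun i e => P.fst_notMem hc hr (mem_ports_bin_fun.2 (.inr ⟨i, e⟩)),
      fun i e => P.snd_notMem hc hr (mem_ports_bin_fun.2 (.inr ⟨i, e⟩))⟩
  have hx : ∀ {r i}, r ∈ (Cell.bin β (x i) (a i .p) (a i .q)).ports ↔ r = x i ∨ ∃ j, r = a i j :=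
    mem_ports_bin_fun
  have hy : ∀ {r i}, r ∈ (Cell.bin α (y i) (b i .p) (b i .q)).ports ↔ r = y i ∨ ∃ j, r = b i j :=
    mem_ports_bin_fun
  refine PreNet.isNet_of ?_ ?_ ?_ ?_
  · intro r s t hs ht
    rcases Finset.mem_union.1 hs with hs | hs <;> rcases Finset.mem_union.1 ht with ht | ht
    · exact hnet.wire_unique hs ht
    · obtain ⟨i, j, ⟨h, -⟩ | ⟨h, -⟩⟩ := mem_commuteWires.1 ht
      exacts [((hwire hs).1 _ _ h).elim, ((hwire hs).2 _ _ h).elim]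
    · obtain ⟨i, j, ⟨h, -⟩ | ⟨h, -⟩⟩ := mem_commuteWires.1 hs
      exacts [((hwire ht).1 _ _ h).elim, ((hwire ht).2 _ _ h).elim]
    · obtain ⟨i, j, ⟨h, rfl⟩ | ⟨h, rfl⟩⟩ := mem_commuteWires.1 hs <;>
        obtain ⟨k, l, ⟨h', rfl⟩ | ⟨h', rfl⟩⟩ := mem_commuteWires.1 ht
      · obtain ⟨rfl, rfl⟩ := F.fst_inj (h.symm.trans h')
        rfl
      · exact (hab _ _ _ _ (h.symm.trans h')).elim
      · exact (hab _ _ _ _ (h'.symm.trans h)).elim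
      · obtain ⟨rfl, rfl⟩ := F.snd_inj (h.symm.trans h')
        rfl
  · intro c hc c' hc' r hr hr'
    rcases Finset.mem_union.1 hc with hc | hc <;> rcases Finset.mem_union.1 hc' with hc' | hc'
    · exact hnet.cell_unique hc hc' hr hr'
    · have := hcell hc r hr
      rcases mem_commuteCells.1 hc' with ⟨i, rfl⟩ | ⟨i, rfl⟩ <;> grind
    · have := hcell hc' r hr'
      rcases mem_commuteCells.1 hc with ⟨i, rfl⟩ | ⟨i, rfl⟩ <;> grind
    · rcases mem_commuteCells.1 hc with ⟨i, rfl⟩ | ⟨i, rfl⟩ <;>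
        rcases mem_commuteCells.1 hc' with ⟨j, rfl⟩ | ⟨j, rfl⟩
      · obtain rfl : i = j := by
          rcases hx.1 hr with h | ⟨k, h⟩ <;> rcases hx.1 hr' with h' | ⟨k', h'⟩
          exacts [P.x_inj (h.symm.trans h'), (hxa _ _ _ (h.symm.trans h')).elim,
            (hxa _ _ _ (h'.symm.trans h)).elim, (F.fst_inj (h.symm.trans h')).1]
        rfl
      · grind
      · grind
      · obtain rfl : i = j := by
          rcases hy.1 hr with h | ⟨k, h⟩ <;> rcases hy.1 hr' with h' | ⟨k', h'⟩
          exacts [P.symm.x_inj (h.symm.trans h'), (hyb _ _ _ (h.symm.trans h')).elim,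
            (hyb _ _ _ (h'.symm.trans h)).elim, (F.snd_inj (h.symm.trans h')).1]
        rfl
  · intro c hc
    rcases Finset.mem_union.1 hc with hc | hc
    · exact hnet.ports_nodup hc
    · rcases mem_commuteCells.1 hc with ⟨i, rfl⟩ | ⟨i, rfl⟩
      · have : a i .p ≠ a i .q := fun h => nomatch (F.fst_inj h).2
        simp [Cell.ports, hxa, this]
      · have : b i .p ≠ b i .q := fun h => nomatch (F.snd_inj h).2
        simp [Cell.ports, hyb, this]
  · intro c hc r hr
    have hold : ∀ {t}, t ∈ (μ.erasePair α p x β q y).interface →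
        ∃ s, s ≠ t ∧ s(t, s) ∈ (μ.commute α p x β q y a b).wires := by
      intro t ht
      obtain ⟨⟨s, hs, hw⟩, -⟩ := hnet.mem_interface_iff.1 ht
      exact ⟨s, hs, Finset.mem_union_left _ hw⟩
    rcases Finset.mem_union.1 hc with hc | hc
    · obtain ⟨s, hs, hw⟩ := hnet.wired hc hr
      exact ⟨s, hs, Finset.mem_union_left _ hw⟩
    · rcases mem_commuteCells.1 hc with ⟨i, rfl⟩ | ⟨i, rfl⟩
      · rcases hx.1 hr with rfl | ⟨j, rfl⟩
        · exact hold (P.x_mem_interface i)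
        · exact ⟨b j i, (hab _ _ _ _).symm,
            Finset.mem_union_right _ (mem_commuteWires.2 ⟨i, j, .inl ⟨rfl, rfl⟩⟩)⟩
      · rcases hy.1 hr with rfl | ⟨j, rfl⟩
        · exact hold (P.y_mem_interface i)
        · exact ⟨a j i, hab _ _ _ _,
            Finset.mem_union_right _ (mem_commuteWires.2 ⟨j, i, .inr ⟨rfl, rfl⟩⟩)⟩

theorem mem_interface_commute_iff {r : Port} :
    r ∈ (μ.commute α p x β q y a b).interface ↔ r ∈ μ.interface := by
  rw [(P.isNet_commute F).mem_interface_iff]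
  constructor
  · rintro ⟨⟨s, hs, hw⟩, hc⟩
    have hx : ∀ i, r ≠ x i := fun i h => hc (.bin β (x i) (a i .p) (a i .q))
      (Finset.mem_union_right _ (mem_commuteCells.2 (.inl ⟨i, rfl⟩))) (mem_ports_bin.2 (.inl h))
    have hy : ∀ i, r ≠ y i := fun i h => hc (.bin α (y i) (b i .p) (b i .q))
      (Finset.mem_union_right _ (mem_commuteCells.2 (.inr ⟨i, rfl⟩))) (mem_ports_bin.2 (.inl h))
    rcases Finset.mem_union.1 hw with hw | hw
    · have := P.isNet_erasePair.mem_interface_iff.2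
        ⟨⟨s, hs, hw⟩, fun c hc' => hc c (Finset.mem_union_left _ hc')⟩
      rcases P.mem_interface_erasePair_iff.1 this with h | ⟨i, h⟩ | ⟨i, h⟩
      exacts [h, (hx i h).elim, (hy i h).elim]
    · exfalso
      obtain ⟨i, j, ⟨rfl, rfl⟩ | ⟨rfl, rfl⟩⟩ := mem_commuteWires.1 hw
      · exact hc (.bin β (x i) (a i .p) (a i .q))
          (Finset.mem_union_right _ (mem_commuteCells.2 (.inl ⟨i, rfl⟩)))
          (mem_ports_bin_fun.2 (.inr ⟨j, rfl⟩))
      · exact hc (.bin α (y j) (b j .p) (b j .q))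
          (Finset.mem_union_right _ (mem_commuteCells.2 (.inr ⟨j, rfl⟩)))
          (mem_ports_bin_fun.2 (.inr ⟨i, rfl⟩))
  · intro hr
    have hr' := P.mem_interface_erasePair_iff.2 (.inl hr)
    obtain ⟨⟨s, hs, hw⟩, hc⟩ := P.isNet_erasePair.mem_interface_iff.1 hr'
    refine ⟨⟨s, hs, Finset.mem_union_left _ hw⟩, fun c hc' hrc => ?_⟩
    have hμ := P.net.mem_interface_iff.1 hr
    obtain ⟨⟨t, -, ht⟩, hμ⟩ := hμ
    rcases Finset.mem_union.1 hc' with hc' | hc'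
    · exact hc c hc' hrc
    · rcases mem_commuteCells.1 hc' with ⟨i, rfl⟩ | ⟨i, rfl⟩
      · rcases mem_ports_bin_fun.1 hrc with h | ⟨j, h⟩
        · exact hμ _ P.fst (mem_ports_bin_fun.2 (.inr ⟨i, h⟩))
        · exact F.notMem_wire i j t (h ▸ ht)
      · rcases mem_ports_bin_fun.1 hrc with h | ⟨j, h⟩
        · exact hμ _ P.snd (mem_ports_bin_fun.2 (.inr ⟨i, h⟩))
        · exact F.symm.notMem_wire i j t (h ▸ ht)

/-- A token crosses the result of a commutation like the active pair itself, but it goes down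
before it goes up. -/
theorem bridge_commute_iff (hαβ : α ≠ β) {s t : Pillar} {K : List Move} :
    Bridge (commuteCells α β x y a b) (commuteWires a b) s t K ↔
      (Crossing α β x y (fun i j => [.down (x i), .up (y j)]) ⊔
        Crossing β α y x (fun i j => [.down (y i), .up (x j)])) s t K := by
  have hnet := P.isNet_commute F
  have hsub : Pass (commuteCells α β x y a b) ≤ Pass (μ.commute α p x β q y a b).cells :=
    Pass.mono fun _ _ _ _ h => Finset.mem_union_right _ h
  have hx : ∀ i, .bin β (x i) (a i .p) (a i .q) ∈ commuteCells α β x y a b :=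
    fun i => mem_commuteCells.2 (.inl ⟨i, rfl⟩)
  have hy : ∀ i, .bin α (y i) (b i .p) (b i .q) ∈ commuteCells α β x y a b :=
    fun i => mem_commuteCells.2 (.inr ⟨i, rfl⟩)
  constructor
  · rintro ⟨c, c', K₁, K₂, h₁, ⟨hw, hu, -⟩, h₂, rfl⟩
    obtain ⟨i, j, ⟨ha, hb⟩ | ⟨hb, ha⟩⟩ := mem_commuteWires.1 hw
    · obtain ⟨u, rfl, rfl, rfl⟩ :=
        (hsub _ _ _ h₁).eq_of_right_aux hnet (Finset.mem_union_right _ (hx i)) ha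
      obtain ⟨v, rfl, rfl, rfl⟩ :=
        (hsub _ _ _ h₂).eq_of_left_aux hnet (Finset.mem_union_right _ (hy j)) hb
      obtain rfl : u = v := hu
      exact .inl ⟨i, j, _, _, (pushLetter_eq_iff hαβ).2 ⟨u, rfl, rfl⟩, rfl, rfl, rfl⟩
    · obtain ⟨u, rfl, rfl, rfl⟩ :=
        (hsub _ _ _ h₁).eq_of_right_aux hnet (Finset.mem_union_right _ (hy j)) hb
      obtain ⟨v, rfl, rfl, rfl⟩ :=
        (hsub _ _ _ h₂).eq_of_left_aux hnet (Finset.mem_union_right _ (hx i)) ha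
      obtain rfl : u = v := hu
      exact .inr ⟨j, i, _, _, (pushLetter_eq_iff hαβ.symm).2 ⟨u, rfl, rfl⟩, rfl, rfl, rfl⟩
  · rintro (⟨i, j, u, v, hu, rfl, rfl, rfl⟩ | ⟨i, j, u, v, hu, rfl, rfl, rfl⟩)
    · obtain ⟨w, rfl, rfl⟩ := (pushLetter_eq_iff hαβ).1 hu
      exact ⟨(w, a i j), (w, b j i), _, _, .down_fun (hx i) j w,
        ⟨mem_commuteWires.2 ⟨i, j, .inl ⟨rfl, rfl⟩⟩, rfl, rfl⟩, .up_fun (hy j) i w, rfl⟩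
    · obtain ⟨w, rfl, rfl⟩ := (pushLetter_eq_iff hαβ.symm).1 hu
      exact ⟨(w, b i j), (w, a j i), _, _, .down_fun (hy i) j w,
        ⟨mem_commuteWires.2 ⟨j, i, .inr ⟨rfl, rfl⟩⟩, rfl, rfl⟩, .up_fun (hx j) i w, rfl⟩

theorem run_commute_iff (hαβ : α ≠ β) {s t : Pillar} {L : List Move}
    (hs : s.2 ∈ μ.interface) (ht : t.2 ∈ μ.interface) :
    (μ.commute α p x β q y a b).Run s t L ↔
      Alt (Wire (μ.erasePair α p x β q y).wires) (Pass (μ.erasePair α p x β q y).cells ⊔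
        (Crossing α β x y (fun i j => [.down (x i), .up (y j)]) ⊔
          Crossing β α y x (fun i j => [.down (y i), .up (x j)]))) s t L := by
  have hbr : Bridge (commuteCells α β x y a b) (commuteWires a b) =
      Crossing α β x y (fun i j => [.down (x i), .up (y j)]) ⊔
        Crossing β α y x (fun i j => [.down (y i), .up (x j)]) := by
    ext s t K
    exact P.bridge_commute_iff F hαβ
  have hfree : ∀ r ∈ μ.interface, ¬∃ i j, r = a i j ∨ r = b i j := by
    rintro r hr ⟨i, j, h⟩
    obtain ⟨⟨t, -, ht⟩, -⟩ := P.net.mem_interface_iff.1 hr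
    rcases h with rfl | rfl
    exacts [F.notMem_wire i j t ht, F.symm.notMem_wire i j t ht]
  rw [PreNet.Run, PreNet.commute,
    alt_union_iff_bridge {r | ∃ i j, r = a i j ∨ r = b i j} ?_ ?_ ?_ ?_ (hfree _ hs) (hfree _ ht),
    hbr]
  · rintro r t h ⟨i, j, rfl | rfl⟩
    exacts [F.notMem_wire i j t (P.mem_wires_iff.1 h).1,
      F.symm.notMem_wire i j t (P.mem_wires_iff.1 h).1]
  · rintro c hc r hr ⟨i, j, rfl | rfl⟩
    exacts [F.notMem_cell (PreNet.mem_of_mem_erasePair hc) i j hr,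
      F.symm.notMem_cell (PreNet.mem_of_mem_erasePair hc) i j hr]
  · intro r t h
    obtain ⟨i, j, ⟨h, -⟩ | ⟨h, -⟩⟩ := mem_commuteWires.1 h
    exacts [⟨i, j, .inl h⟩, ⟨j, i, .inr h⟩]
  · have hx : ∀ k, ¬∃ i j, x k = a i j ∨ x k = b i j := by
      rintro k ⟨i, j, h | h⟩
      exacts [P.x_ne_a F _ _ _ h, P.x_ne_a F.symm _ _ _ h]
    have hy : ∀ k, ¬∃ i j, y k = a i j ∨ y k = b i j := by
      rintro k ⟨i, j, h | h⟩
      exacts [P.y_ne_a F _ _ _ h, P.y_ne_a F.symm _ _ _ h]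
    have ha : ∀ k l, ∃ i j, a k l = a i j ∨ a k l = b i j := fun k l => ⟨k, l, .inl rfl⟩
    have hb : ∀ k l, ∃ i j, b k l = a i j ∨ b k l = b i j := fun k l => ⟨k, l, .inr rfl⟩
    rintro s t K (⟨l, u, hc⟩ | ⟨l, u, hc⟩) <;>
      rcases mem_commuteCells.1 hc with ⟨i, h⟩ | ⟨i, h⟩ <;> cases h <;>
      simp only [pick_apply, Set.mem_ofPred_eq, hx, hy, ha, hb, not_true, not_false_iff]

end ActivePair

theorem PreNet.IsNet.exists_isFresh {μ : PreNet} (h : μ.IsNet) : ∃ a b, IsFresh μ a b := by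
  obtain ⟨(N : ℕ), hN⟩ := (μ.wires.biUnion Sym2.toFinset).bddAbove
  have hfresh : ∀ k, μ.occ (N + 1 + k) = 0 := by
    intro k
    by_contra hk
    obtain ⟨a, ha⟩ := h.exists_wire (Nat.pos_of_ne_zero hk)
    have : N + 1 + k ≤ N := hN (mem_wirePorts.2 ⟨a, ha⟩)
    omega
  refine ⟨fun i j => N + 1 + pick (pick 0 1 j) (pick 2 3 j) i,
    fun i j => N + 1 + pick (pick 4 5 j) (pick 6 7 j) i, fun _ _ => hfresh _, fun _ _ => hfresh _,
    ?_, ?_, ?_⟩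
  · rintro (_ | _) (_ | _) (_ | _) (_ | _) h <;> simp [pick] at h ⊢
  · rintro (_ | _) (_ | _) (_ | _) (_ | _) h <;> simp [pick] at h ⊢
  · rintro (_ | _) (_ | _) (_ | _) (_ | _) <;> simp [pick]

/-! ### Annihilation of an active pair -/

/-- A feedback that joins the auxiliary ports of an active pair. -/
structure Joins (σ : Feedback) (x y : Letter → Port) : Prop where
  dom : σ.dom = {x .p, x .q, y .p, y .q}
  apply : ∀ i, σ (x i) = y i

namespace Joins

variable {σ : Feedback} {x y : Letter → Port} (J : Joins σ x y)
include J

theorem mem_dom_iff {r : Port} : r ∈ σ.dom ↔ (∃ i, r = x i) ∨ ∃ i, r = y i := by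
  rw [J.dom]
  simp only [Finset.mem_insert, Finset.mem_singleton]
  constructor
  · rintro (h | h | h | h)
    exacts [.inl ⟨_, h⟩, .inl ⟨_, h⟩, .inr ⟨_, h⟩, .inr ⟨_, h⟩]
  · rintro (⟨_ | _, rfl⟩ | ⟨_ | _, rfl⟩) <;> simp

theorem apply_symm (i : Letter) : σ (y i) = x i := by
  rw [← J.apply, σ.invol _ (J.mem_dom_iff.2 (.inl ⟨i, rfl⟩))]

/-- Joining the auxiliary ports has the effect of going through both cells, as the letter pushed
by the first one is the letter popped by the second one. -/
theorem jump_eq (α : BinSymbol) :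
    Jump σ = Crossing α α x y (fun _ _ => []) ⊔ Crossing α α y x (fun _ _ => []) := by
  ext ⟨u, r⟩ ⟨v, t⟩ K
  constructor
  · rintro ⟨hr, ht, hv, hK⟩
    rcases J.mem_dom_iff.1 hr with ⟨i, h⟩ | ⟨i, h⟩ <;> simp only at h hv ht <;> subst h hv
    · rw [J.apply] at ht
      exact .inl ⟨i, i, _, _, rfl, rfl, by rw [ht], hK⟩
    · rw [J.apply_symm] at ht
      exact .inr ⟨i, i, _, _, rfl, rfl, by rw [ht], hK⟩
  · rintro (⟨i, j, u, v, h, h₁, h₂, rfl⟩ | ⟨i, j, u, v, h, h₁, h₂, rfl⟩) <;> cases h₁ <;>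
      cases h₂ <;> obtain ⟨rfl, rfl⟩ := pushLetter_inj.1 h
    · exact ⟨J.mem_dom_iff.2 (.inl ⟨i, rfl⟩), (J.apply i).symm, rfl, rfl⟩
    · exact ⟨J.mem_dom_iff.2 (.inr ⟨i, rfl⟩), (J.apply_symm i).symm, rfl, rfl⟩

end Joins

namespace ActivePair

section Annihilate

variable {μ : PreNet} {α β : BinSymbol} {p q : Port} {x y : Letter → Port} {σ : Feedback}
  (P : ActivePair μ α p x β q y) (J : Joins σ x y)
include P

theorem exists_joins : ∃ σ, Joins σ x y := by
  have hx : x .p ≠ x .q := fun h => nomatch P.x_inj h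
  have hy : y .p ≠ y .q := fun h => nomatch P.symm.x_inj h
  have hxy := P.x_ne_y
  have h₁ := hxy .p .p
  have h₂ := hxy .p .q
  have h₃ := hxy .q .p
  have h₄ := hxy .q .q
  refine ⟨⟨{x .p, x .q, y .p, y .q}, fun r => if r = x .p then y .p else if r = x .q then y .q
    else if r = y .p then x .p else x .q, ?_, ?_, ?_⟩, rfl, ?_⟩
  · intro r hr
    simp only [Finset.mem_insert, Finset.mem_singleton] at hr ⊢
    grind
  · intro r hr
    simp only [Finset.mem_insert, Finset.mem_singleton] at hr ⊢
    grind
  · intro r hr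
    simp only [Finset.mem_insert, Finset.mem_singleton] at hr ⊢
    grind
  · rintro (_ | _)
    · simp
    · simp [hx.symm]

include J

theorem dom_subset : ↑σ.dom ⊆ (μ.erasePair α p x β q y).interface := by
  intro r hr
  exact P.mem_interface_erasePair_iff.2 (.inr (J.mem_dom_iff.1 hr))

theorem notMem_dom {r : Port} (hr : r ∈ μ.interface) : r ∉ σ.dom := by
  intro h
  have hμ := (P.net.mem_interface_iff.1 hr).2
  rcases J.mem_dom_iff.1 h with h | h
  · exact hμ _ P.fst (mem_ports_bin_fun.2 (.inr h))
  · exact hμ _ P.snd (mem_ports_bin_fun.2 (.inr h))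

theorem mem_interface_annihilate_iff {r : Port} :
    r ∈ ((μ.erasePair α p x β q y).plug σ).interface ↔ r ∈ μ.interface := by
  rw [P.isNet_erasePair.mem_interface_plug_iff (P.dom_subset J), P.mem_interface_erasePair_iff,
    J.mem_dom_iff]
  constructor
  · rintro ⟨h | h, h'⟩
    exacts [h, (h' h).elim]
  · intro h
    exact ⟨.inl h, J.mem_dom_iff.not.1 (P.notMem_dom J h)⟩

omit P in
theorem run_annihilate_iff (P : ActivePair μ α p x α q y) {s t : Pillar} {L : List Move}
    (hs : s.2 ∈ μ.interface) (ht : t.2 ∈ μ.interface) :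
    ((μ.erasePair α p x α q y).plug σ).Run s t L ↔
      Alt (Wire (μ.erasePair α p x α q y).wires) (Pass (μ.erasePair α p x α q y).cells ⊔
        (Crossing α α x y (fun _ _ => []) ⊔ Crossing α α y x (fun _ _ => []))) s t L := by
  rw [PreNet.run_plug_iff (P.isNet_erasePair.notMem_dom (P.dom_subset J)) (P.notMem_dom J hs),
    J.jump_eq α]
  exact and_iff_left (P.notMem_dom J ht)

end Annihilate

/-! ### Runs and reduction -/

variable {μ : PreNet} {α β : BinSymbol} {p q : Port} {x y : Letter → Port}
  (P : ActivePair μ α p x β q y) {M N : Letter → Letter → List Move} {s t : Pillar} {L : List Move}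
include P

/-- A run that crosses the active pair `p`, `q` upwards through `p` gets lighter when the
crossings do. -/
theorem exists_alt_weight_lt (hM : ∀ i j n, weight (M i j) n < weight [.up p, .down q] n)
    (hN : ∀ i j n, weight (N i j) n < weight [.up q, .down p] n)
    (hs : s.2 ∈ μ.interface) (ht : t.2 ∈ μ.interface) (h : μ.Run s t L) (hp : .up p ∈ L) :
    ∃ L', Alt (Wire (μ.erasePair α p x β q y).wires) (Pass (μ.erasePair α p x β q y).cells ⊔
        (Crossing α β x y M ⊔ Crossing β α y x N)) s t L' ∧ weight L' 0 < weight L 0 := by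
  rw [P.run_iff (P.ne_of_mem_interface hs) (P.ne_of_mem_interface ht)] at h
  rcases h.exists_weight_lt (P' := Crossing α β x y M ⊔ Crossing β α y x N) (by
    rintro s t K (h | h)
    · obtain ⟨K', h, hlt⟩ := h.exists_weight_lt hM
      exact ⟨K', .inl h, hlt⟩
    · obtain ⟨K', h, hlt⟩ := h.exists_weight_lt hN
      exact ⟨K', .inr h, hlt⟩) with h | ⟨L', h, hlt⟩
  · -- A run without crossings only passes the remaining cells, none of which has the port `p`.
    obtain ⟨γ, z₁, z₂, hc⟩ := PreNet.Run.exists_mem_cells (μ := μ.erasePair α p x β q y) h hp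
    exact (P.fst_notMem hc (principal_mem_ports _) (mem_ports_bin.2 (.inl rfl))).elim
  · exact ⟨L', h, hlt 0⟩

theorem exists_run_of_alt (hs : s.2 ∈ μ.interface) (ht : t.2 ∈ μ.interface)
    (h : Alt (Wire (μ.erasePair α p x β q y).wires) (Pass (μ.erasePair α p x β q y).cells ⊔
        (Crossing α β x y M ⊔ Crossing β α y x N)) s t L) : ∃ L', μ.Run s t L' := by
  obtain ⟨L', h⟩ := h.exists_map (B' := Pass (μ.erasePair α p x β q y).cells ⊔
    (Crossing α β x y (fun _ _ => [.up p, .down q]) ⊔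
      Crossing β α y x (fun _ _ => [.up q, .down p]))) (by
    rintro s t K (h | h | h)
    · exact ⟨_, .inl h⟩
    · exact h.exists_map.imp fun _ h => .inr (.inl h)
    · exact h.exists_map.imp fun _ h => .inr (.inr h))
  exact ⟨L', (P.run_iff (P.ne_of_mem_interface hs) (P.ne_of_mem_interface ht)).2 h⟩

end ActivePair

/-- Reducing an active pair that a run crosses makes the run lighter. -/
theorem Net.exists_step_weight_lt {μ : Net} {α β : BinSymbol} {p q : Port} {x y : Letter → Port}
    (P : ActivePair μ.toPreNet α p x β q y) {s t : Pillar} {L : List Move}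
    (hs : s.2 ∈ μ.interface) (ht : t.2 ∈ μ.interface) (h : μ.Run s t L) (hp : .up p ∈ L) :
    ∃ (μ' : Net) (L' : List Move), Step μ μ' ∧ μ'.interface = μ.interface ∧ μ'.Run s t L' ∧
      weight L' 0 < weight L 0 := by
  by_cases hαβ : α = β
  · subst hαβ
    obtain ⟨σ, J⟩ := P.exists_joins
    obtain ⟨L', h', hlt⟩ := P.exists_alt_weight_lt (M := fun _ _ => []) (N := fun _ _ => [])
      (fun _ _ n => by simp only [weight]; omega) (fun _ _ n => by simp only [weight]; omega)
      hs ht h hp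
    exact ⟨⟨_, P.isNet_erasePair.plug (P.dom_subset J)⟩, L',
      .annihilate α p _ _ q _ _ σ P.fst P.snd P.wire J.dom (J.apply _) (J.apply _) rfl,
      Set.ext fun _ => P.mem_interface_annihilate_iff J, (P.run_annihilate_iff J hs ht).2 h', hlt⟩
  · obtain ⟨a, b, F⟩ := μ.isNet.exists_isFresh
    obtain ⟨L', h', hlt⟩ := P.exists_alt_weight_lt (M := fun i j => [.down (x i), .up (y j)])
      (N := fun i j => [.down (y i), .up (x j)])
      (fun _ _ n => by simp only [weight]; omega) (fun _ _ n => by simp only [weight]; omega)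
      hs ht h hp
    refine ⟨⟨_, P.isNet_commute F⟩, L',
      .commute α β hαβ p _ _ q _ _ (a .p .p) (a .p .q) (a .q .p) (a .q .q)
        (b .p .p) (b .p .q) (b .q .p) (b .q .q) P.fst P.snd P.wire ?_ ?_ rfl,
      Set.ext fun _ => P.mem_interface_commute_iff F, (P.run_commute_iff F hαβ hs ht).2 h', hlt⟩
    · have h₁ : ∀ i j k l, a i j = a k l → i = k ∧ j = l := fun _ _ _ _ => F.fst_inj
      have h₂ : ∀ i j k l, b i j = b k l → i = k ∧ j = l := fun _ _ _ _ => F.snd_inj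
      have h₃ := F.ne
      simp only [List.nodup_cons, List.mem_cons, List.not_mem_nil, or_false, not_or,
        not_false_iff, List.nodup_nil, and_true, h₃]
      grind
    · simp [F.fst, F.snd]

/-- Every run in a reduct comes from a run of the net. -/
theorem Step.exists_run {μ μ' : Net} (h : Step μ μ') : μ'.interface ⊆ μ.interface ∧
    ∀ {s t : Pillar} {L : List Move}, s.2 ∈ μ.interface → t.2 ∈ μ.interface → μ'.Run s t L →
      ∃ L', μ.Run s t L' := by
  -- When an `ε` cell is involved, the reduct has fewer wires and no new binary cell.
  have heps : ∀ c d : Cell, s(c.principal, d.principal) ∈ μ.wires →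
      μ'.wires = μ.wires \ {s(c.principal, d.principal)} →
      (∀ e ∈ μ.cells, e ≠ c → e ≠ d → e ∈ μ'.cells) →
      (∀ r, r ∈ c.ports ∨ r ∈ d.ports →
        r = c.principal ∨ r = d.principal ∨ ∃ e ∈ μ'.cells, r ∈ e.ports) →
      (∀ α p x₁ x₂, .bin α p x₁ x₂ ∈ μ'.cells → .bin α p x₁ x₂ ∈ μ.cells) →
      μ'.interface ⊆ μ.interface ∧ ∀ {s t : Pillar} {L : List Move}, s.2 ∈ μ.interface →
        t.2 ∈ μ.interface → μ'.Run s t L → ∃ L', μ.Run s t L' := by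
    intro c d hcd hw hcells hports hbin
    constructor
    · intro r hr
      obtain ⟨⟨b, hb, hrb⟩, hr⟩ := μ'.isNet.mem_interface_iff.1 hr
      rw [hw, Finset.mem_sdiff, Finset.mem_singleton] at hrb
      have hc : r ≠ c.principal := by
        rintro rfl
        exact hrb.2 (by rw [μ.isNet.wire_unique hrb.1 hcd])
      have hd : r ≠ d.principal := by
        rintro rfl
        exact hrb.2 (by rw [μ.isNet.wire_unique hrb.1 (Sym2.eq_swap ▸ hcd), Sym2.eq_swap])
      have hcd' : ¬(r ∈ c.ports ∨ r ∈ d.ports) := fun h => by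
        rcases hports r h with h | h | ⟨e, he, hre⟩
        exacts [hc h, hd h, hr e he hre]
      refine μ.isNet.mem_interface_iff.2 ⟨⟨b, hb, hrb.1⟩, fun e he hre => ?_⟩
      refine hr e (hcells e he ?_ ?_) hre
      · rintro rfl
        exact hcd' (.inl hre)
      · rintro rfl
        exact hcd' (.inr hre)
    · intro s t L _ _ h
      exact ⟨L, h.mono (Wire.mono (hw ▸ Finset.sdiff_subset)) (Pass.mono hbin)⟩
  cases h with
  | annihilate α p x₁ x₂ q y₁ y₂ σ hc hd hw hdom h₁ h₂ hμ' =>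
    have P : ActivePair μ.toPreNet α p (pick x₁ x₂) α q (pick y₁ y₂) := ⟨μ.isNet, hc, hd, hw⟩
    have J : Joins σ (pick x₁ x₂) (pick y₁ y₂) := ⟨hdom, by rintro (_ | _) <;> assumption⟩
    have hμ' : μ'.toPreNet =
        (μ.erasePair α p (pick x₁ x₂) α q (pick y₁ y₂)).plug σ := hμ'
    rw [hμ']
    exact ⟨fun r hr => (P.mem_interface_annihilate_iff J).1 hr, fun hs ht h =>
      P.exists_run_of_alt hs ht ((P.run_annihilate_iff J hs ht).1 h)⟩
  | commute α β hαβ p x₁ x₂ q y₁ y₂ a₁₁ a₁₂ a₂₁ a₂₂ b₁₁ b₁₂ b₂₁ b₂₂ hc hd hw hn hf hμ' =>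
    have P : ActivePair μ.toPreNet α p (pick x₁ x₂) β q (pick y₁ y₂) := ⟨μ.isNet, hc, hd, hw⟩
    have F : IsFresh μ.toPreNet (pick (pick a₁₁ a₁₂) (pick a₂₁ a₂₂))
        (pick (pick b₁₁ b₁₂) (pick b₂₁ b₂₂)) := .of_nodup hn hf
    have hμ' : μ'.toPreNet = μ.commute α p (pick x₁ x₂) β q (pick y₁ y₂)
      (pick (pick a₁₁ a₁₂) (pick a₂₁ a₂₂)) (pick (pick b₁₁ b₁₂) (pick b₂₁ b₂₂)) := hμ'
    rw [hμ']
    exact ⟨fun r hr => (P.mem_interface_commute_iff F).1 hr, fun hs ht h =>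
      P.exists_run_of_alt hs ht ((P.run_commute_iff F hαβ hs ht).1 h)⟩
  | annihilateEps p q hc hd hw hμ' =>
    refine heps (.eps p) (.eps q) hw (by rw [hμ']; rfl) ?_ ?_ ?_
    · intro e he h₁ h₂
      simp [hμ', he, h₁, h₂]
    · rintro r (h | h)
      exacts [.inl (mem_ports_eps.1 h), .inr (.inl (mem_ports_eps.1 h))]
    · simp only [hμ', Finset.mem_sdiff]
      exact fun _ _ _ _ h => h.1
  | erase α p q y₁ y₂ hc hd hw hμ' =>
    refine heps (.eps p) (.bin α q y₁ y₂) hw (by rw [hμ']; rfl) ?_ ?_ ?_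
    · intro e he h₁ h₂
      simp [hμ', he, h₁, h₂]
    · rintro r (h | h)
      · exact .inl (mem_ports_eps.1 h)
      · rcases mem_ports_bin.1 h with h | rfl | rfl
        · exact .inr (.inl h)
        · exact .inr (.inr ⟨.eps r, by simp [hμ'], mem_ports_eps.2 rfl⟩)
        · exact .inr (.inr ⟨.eps r, by simp [hμ'], mem_ports_eps.2 rfl⟩)
    · intro β r x₁ x₂ h
      simp only [hμ', Finset.mem_union, Finset.mem_sdiff, Finset.mem_insert,
        Finset.mem_singleton, reduceCtorEq, or_false] at h
      exact h.1

theorem Reduces.exists_run {μ μ' : Net} (h : Reduces μ μ') : μ'.interface ⊆ μ.interface ∧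
    ∀ {s t : Pillar} {L : List Move}, s.2 ∈ μ'.interface → t.2 ∈ μ'.interface → μ'.Run s t L →
      ∃ L', μ.Run s t L' := by
  induction h with
  | refl => exact ⟨subset_rfl, fun _ _ h => ⟨_, h⟩⟩
  | tail _ h ih =>
    refine ⟨h.exists_run.1.trans ih.1, fun hs ht hr => ?_⟩
    obtain ⟨L', hr⟩ := h.exists_run.2 (h.exists_run.1 hs) (h.exists_run.1 ht) hr
    exact ih.2 (h.exists_run.1 hs) (h.exists_run.1 ht) hr

/-! ### Observable axioms and runs -/

namespace PreNet

/-- `μ.Branch r p s`: some tree of `μ` with root `r` has a leaf at `p`, with the pair of words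
`s`. -/
inductive Branch (μ : PreNet) : Port → Port → FinPair → Prop
  | nil (r : Port) : Branch μ r r ([], [])
  | cons {α : BinSymbol} {r p x₁ x₂ t : Port} {s : FinPair} (l : Letter) :
      s(r, p) ∈ μ.wires → .bin α p x₁ x₂ ∈ μ.cells → Branch μ (pick x₁ x₂ l) t s →
      Branch μ r t (consLetter l α s)

variable {μ : PreNet}

theorem Branch.snoc {r t p x₁ x₂ : Port} {s : FinPair} {α : BinSymbol} (h : μ.Branch r t s)
    (l : Letter) (hw : s(t, p) ∈ μ.wires) (hc : .bin α p x₁ x₂ ∈ μ.cells) :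
    ∃ s', μ.Branch r (pick x₁ x₂ l) s' ∧
      ∀ u, FinPair.append s' u = FinPair.append s (pushLetter l α u) := by
  induction h with
  | nil r => exact ⟨_, .cons l hw hc (.nil _), fun u => by rw [append_consLetter]; rfl⟩
  | cons l' hw' hc' _ ih =>
    obtain ⟨s', h, hs⟩ := ih hw
    exact ⟨_, .cons l' hw' hc' h, fun u => by rw [append_consLetter, append_consLetter, hs]⟩

/-- A leaf is the root or an auxiliary port of a cell. -/
theorem Branch.eq_or_exists {r t : Port} {s : FinPair} (h : μ.Branch r t s) :
    t = r ∨ ∃ α p x₁ x₂ l, .bin α p x₁ x₂ ∈ μ.cells ∧ t = pick x₁ x₂ l := by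
  induction h with
  | nil r => exact .inl rfl
  | cons l _ hc _ ih =>
    rcases ih with rfl | h
    · exact .inr ⟨_, _, _, _, l, hc, rfl⟩
    · exact .inr h

/-- A token that starts at a leaf can be made to start at the root, with more letters. -/
theorem Branch.exists_run_root {r t : Port} {s : FinPair} {w : InfPair} {y : Pillar}
    {L : List Move} (h : μ.Branch r t s) (hr : μ.Run (w, t) y L) :
    ∃ L', μ.Run (FinPair.append s w, r) y L' := by
  induction h with
  | nil r => exact ⟨L, hr⟩
  | cons l hw hc _ ih =>
    obtain ⟨L', h⟩ := ih hr
    rw [append_consLetter]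
    exact ⟨_, .cons (b := (_, _)) ⟨hw, rfl, rfl⟩ (.down l _ hc) h⟩

/-- An axiom whose two ports are leaves is followed by a token that goes down the first branch
and up the second one. -/
theorem Branch.exists_run {r r' t t' : Port} {s s' : FinPair} (h : μ.Branch r t s)
    (h' : μ.Branch r' t' s') (hw : s(t, t') ∈ μ.wires) (w : InfPair) :
    ∃ L, μ.Run (FinPair.append s w, r) (FinPair.append s' w, r') L := by
  obtain ⟨L, hL⟩ := h'.exists_run_root (w := w) (y := (w, t)) (.base ⟨Sym2.eq_swap ▸ hw, rfl, rfl⟩)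
  obtain ⟨L, hL⟩ := Run.exists_symm hL
  exact h.exists_run_root hL

/-- A run either goes up to a cell and straight down the other cell of an active pair, or goes
down a branch and then up another one. -/
theorem Run.exists_activePair_or_branch (hμ : μ.IsNet) {a b : Pillar} {L : List Move}
    (h : μ.Run a b L) :
    (∃ α p x β q y, ActivePair μ α p x β q y ∧ .up p ∈ L) ∨
      ∃ r t s s' w, μ.Branch a.2 r s ∧ μ.Branch b.2 t s' ∧ s(r, t) ∈ μ.wires ∧
        a.1 = FinPair.append s w ∧ b.1 = FinPair.append s' w := by
  induction h with
  | @base a b _ h => exact .inr ⟨a.2, b.2, _, _, a.1, .nil _, .nil _, h.1, rfl, h.2.1.symm⟩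
  | cons h₁ h₂ _ ih =>
    rcases ih with ⟨α, p, x, β, q, y, P, hp⟩ | ⟨r, t, s, s', w, hr, ht, hrt, ha, hb⟩
    · exact .inl ⟨α, p, x, β, q, y, P, by simp [hp]⟩
    · obtain ⟨hw, hu, rfl⟩ := h₁
      cases h₂ with
      | down l u hc =>
        refine .inr ⟨r, t, _, s', w, .cons l hw hc hr, ht, hrt, ?_, hb⟩
        rw [append_consLetter, ← ha, hu]
      | @up α p x₁ x₂ l u hc =>
        generalize hp : (pushLetter l α u, p).2 = p' at hr
        cases hr with
        | nil =>
          subst hp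
          obtain ⟨s'', hs, hs'⟩ := ht.snoc l (Sym2.eq_swap ▸ hrt) hc
          refine .inr ⟨_, _, ([], []), s'', u, .nil _, hs, hw, hu, ?_⟩
          rw [hs', hb]
          congr 1
          exact ha.symm
        | @cons β _ q y₁ y₂ _ _ _ hw' hc' _ =>
          subst hp
          exact .inl ⟨α, p, pick x₁ x₂, β, q, pick y₁ y₂, ⟨hμ, hc, hc', hw'⟩, by simp⟩

end PreNet

theorem Net.branch_iff {μ : Net} {r p : Port} {s : FinPair} :
    μ.Branch r p s ↔ ∃ τ, μ.ContainsTree r τ ∧ τ.Br p s := by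
  constructor
  · intro h
    induction h with
    | nil r => exact ⟨_, .leaf r, .leaf r⟩
    | cons l hw hc _ ih =>
      obtain ⟨τ, hτ, hs⟩ := ih
      cases l
      exacts [⟨_, .node hc hw hτ (.leaf _), .left hs⟩, ⟨_, .node hc hw (.leaf _) hτ, .right hs⟩]
  · rintro ⟨τ, hτ, hs⟩
    induction hs generalizing r with
    | leaf p =>
      cases hτ
      exact .nil _
    | left _ ih =>
      cases hτ with
      | node hc hw h₁ _ => exact .cons .p hw hc (ih h₁)
    | right _ ih =>
      cases hτ with
      | node hc hw _ h₂ => exact .cons .q hw hc (ih h₂)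

/-- A leaf of a tree rooted at a free port is not principal, and is not the port of a loop. -/
theorem PreNet.Branch.proper {μ : PreNet} (hμ : μ.IsNet) {i p : Port} {s : FinPair}
    (h : μ.Branch i p s) (hi : i ∈ μ.interface) :
    (∀ c ∈ μ.cells, c.principal ≠ p) ∧ s(p, p) ∉ μ.wires := by
  have hi' := hμ.mem_interface_iff.1 hi
  rcases h.eq_or_exists with rfl | ⟨α, p₀, x₁, x₂, l, hc, rfl⟩
  · refine ⟨fun c hc h => hi'.2 c hc (h ▸ principal_mem_ports c), fun h => ?_⟩
    obtain ⟨⟨b, hb, hw⟩, -⟩ := hi'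
    exact hb (hμ.wire_unique hw h)
  · constructor
    · rintro c hc' h
      obtain rfl := hμ.cell_unique hc hc' (pick_mem_ports l) (h ▸ principal_mem_ports c)
      exact hμ.aux_ne (x := pick x₁ x₂) hc l h.symm
    · intro h
      obtain ⟨b, hb, hw⟩ := hμ.wired hc (pick_mem_ports l)
      exact hb (hμ.wire_unique hw h)

theorem Net.mem_obs_of_branch {μ : Net} {i j p q : Port} {s t : FinPair} (hi : i ∈ μ.interface)
    (hj : j ∈ μ.interface) (hp : μ.Branch i p s) (hq : μ.Branch j q t) (hw : s(p, q) ∈ μ.wires) :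
    s((s, i), (t, j)) ∈ μ.obs := by
  obtain ⟨τ, hτ, hs⟩ := branch_iff.1 hp
  obtain ⟨τ', hτ', ht⟩ := branch_iff.1 hq
  have hp' := hp.proper μ.isNet hi
  have hq' := hq.proper μ.isNet hj
  refine ⟨p, q, i, j, τ, τ', s, t, ⟨hw, ?_, fun c hc => ⟨hp'.1 c hc, hq'.1 c hc⟩⟩, hi, hj, hτ, hτ',
    hs, ht, rfl⟩
  rintro rfl
  exact hp'.2 hw

/-! ### The edifice of a net -/

/-- Every run between free ports becomes an observable axiom along some reduction, as reducing
the active pairs that it crosses makes it lighter. -/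
theorem Net.mem_edifice_of_run {μ : Net} {a b : Pillar} {L : List Move} (ha : a.2 ∈ μ.interface)
    (hb : b.2 ∈ μ.interface) (h : μ.Run a b L) : s(a, b) ∈ μ.edifice := by
  suffices H : ∃ x ∈ μ.allObs, s(a, b) ∈ vault x by
    obtain ⟨x, hx, hab⟩ := H
    exact Set.mem_biUnion hx hab
  induction hn : weight L 0 using Nat.strong_induction_on generalizing μ L with
  | _ n ih =>
    rcases h.exists_activePair_or_branch μ.isNet with
      ⟨α, p, x, β, q, y, P, hp⟩ | ⟨r, t, s, s', w, hr, ht, hrt, ha', hb'⟩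
    · obtain ⟨μ', L', hstep, hint, h', hlt⟩ := Net.exists_step_weight_lt P ha hb h hp
      obtain ⟨x, ⟨μ'', hred, hx⟩, hab⟩ :=
        ih _ (hn ▸ hlt) (hint ▸ ha) (hint ▸ hb) h' rfl
      exact ⟨x, ⟨μ'', .head hstep hred, hx⟩, hab⟩
    · refine ⟨_, ⟨μ, .refl, mem_obs_of_branch ha hb hr ht hrt⟩, w, ?_⟩
      simp only [Sym2.map_mk, ← ha', ← hb']

/-- The edifice of a net consists of the arches between the two ends of a run. -/
theorem Net.mem_edifice_iff {μ : Net} {a b : Pillar} :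
    s(a, b) ∈ μ.edifice ↔ a.2 ∈ μ.interface ∧ b.2 ∈ μ.interface ∧ ∃ L, μ.Run a b L := by
  constructor
  · intro h
    obtain ⟨x, ⟨μ', hred, hx⟩, w, hw⟩ := Set.mem_iUnion₂.1 h
    obtain ⟨p, q, i, j, τ, τ', s, t, hpq, hi, hj, hτ, hτ', hs, ht, rfl⟩ := hx
    obtain ⟨L, hL⟩ := (Net.branch_iff.2 ⟨τ, hτ, hs⟩).exists_run (Net.branch_iff.2 ⟨τ', hτ', ht⟩)
      hpq.1 w
    obtain ⟨hsub, hrun⟩ := hred.exists_run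
    obtain ⟨L, hL⟩ := hrun hi hj hL
    simp only [Sym2.map_mk] at hw
    rcases Sym2.eq_iff.1 hw with ⟨rfl, rfl⟩ | ⟨rfl, rfl⟩
    · exact ⟨hsub hi, hsub hj, L, hL⟩
    · exact ⟨hsub hj, hsub hi, hL.exists_symm⟩
  · rintro ⟨ha, hb, L, h⟩
    exact mem_edifice_of_run ha hb h

/-! ### The trace -/

theorem isTraceSeq_singleton {σ : Feedback} {E : Edifice} {a : Pillar × Pillar} :
    IsTraceSeq σ E [a] ↔ s(a.1, a.2) ∈ E :=
  ⟨fun h => h.mem a (by simp), fun h => ⟨by simp, by simpa using h, by simp⟩⟩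

theorem isTraceSeq_cons_cons {σ : Feedback} {E : Edifice} {a b : Pillar × Pillar}
    {l : List (Pillar × Pillar)} : IsTraceSeq σ E (a :: b :: l) ↔
      s(a.1, a.2) ∈ E ∧ Jump σ a.2 b.1 [] ∧ IsTraceSeq σ E (b :: l) := by
  constructor
  · rintro ⟨-, hmem, hchain⟩
    rw [List.isChain_cons_cons] at hchain
    exact ⟨hmem a (by simp), ⟨hchain.1.1.1, hchain.1.1.2, hchain.1.2, rfl⟩, by simp,
      fun c hc => hmem c (List.mem_cons_of_mem _ hc), hchain.2⟩
  · rintro ⟨ha, hj, h⟩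
    refine ⟨by simp, ?_, List.isChain_cons_cons.2 ⟨⟨⟨hj.1, hj.2.1⟩, hj.2.2.1⟩, h.chain_match⟩⟩
    intro c hc
    rcases List.mem_cons.1 hc with rfl | hc
    exacts [ha, h.mem c hc]

/-- The trace sequences of the edifice of a net are the alternations of runs and jumps. -/
theorem Net.exists_isTraceSeq_iff {μ : Net} {σ : Feedback} (hσ : ↑σ.dom ⊆ μ.interface)
    {x y : Pillar} :
    (∃ (l : List (Pillar × Pillar)) (h : IsTraceSeq σ μ.edifice l),
      (l.head h.ne_nil).1 = x ∧ (l.getLast h.ne_nil).2 = y) ↔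
    x.2 ∈ μ.interface ∧ y.2 ∈ μ.interface ∧ ∃ L, Alt μ.Run (Jump σ) x y L := by
  constructor
  · rintro ⟨l, h, rfl, rfl⟩
    induction l with
    | nil => exact (h.ne_nil rfl).elim
    | cons a l ih =>
      cases l with
      | nil =>
        obtain ⟨h₁, h₂, L, h⟩ := mem_edifice_iff.1 (isTraceSeq_singleton.1 h)
        exact ⟨h₁, h₂, L, .base h⟩
      | cons b l =>
        obtain ⟨ha, hj, h'⟩ := isTraceSeq_cons_cons.1 h
        obtain ⟨h₁, -, L, h⟩ := mem_edifice_iff.1 ha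
        obtain ⟨-, h₂, L', ih⟩ := ih h'
        exact ⟨h₁, h₂, _, .cons h hj ih⟩
  · rintro ⟨hx, hy, L, h⟩
    induction h with
    | @base x y L h =>
      exact ⟨[(x, y)], isTraceSeq_singleton.2 (mem_edifice_iff.2 ⟨hx, hy, L, h⟩), rfl, rfl⟩
    | @cons x b z y K K' L h₁ h₂ _ ih =>
      obtain ⟨hb, hz, hbz, rfl⟩ := h₂
      obtain ⟨l, h, hhead, hlast⟩ := ih (hσ (hz ▸ σ.mem_dom _ hb)) hy
      cases l with
      | nil => exact (h.ne_nil rfl).elim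
      | cons c l =>
        obtain rfl : c.1 = z := hhead
        exact ⟨(x, b) :: c :: l, isTraceSeq_cons_cons.2
          ⟨mem_edifice_iff.2 ⟨hx, hσ hb, _, h₁⟩, ⟨hb, hz, hbz, rfl⟩, h⟩, rfl, hlast⟩

theorem Net.mem_trace_iff {μ : Net} {σ : Feedback} (hσ : ↑σ.dom ⊆ μ.interface) {e : Arch} :
    e ∈ trace σ μ.edifice ↔ ∃ x y, e = s(x, y) ∧ (x.2 ∈ μ.interface ∧ x.2 ∉ σ.dom) ∧
      (y.2 ∈ μ.interface ∧ y.2 ∉ σ.dom) ∧ ∃ L, Alt μ.Run (Jump σ) x y L := by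
  constructor
  · rintro ⟨l, h, ⟨h₁, h₂⟩, rfl⟩
    obtain ⟨hx, hy, hL⟩ := (exists_isTraceSeq_iff hσ).1 ⟨l, h, rfl, rfl⟩
    exact ⟨_, _, rfl, ⟨hx, h₁⟩, ⟨hy, h₂⟩, hL⟩
  · rintro ⟨x, y, rfl, ⟨hx, hx'⟩, ⟨hy, hy'⟩, hL⟩
    obtain ⟨l, h, rfl, rfl⟩ := (exists_isTraceSeq_iff hσ).2 ⟨hx, hy, hL⟩
    exact ⟨l, h, ⟨hx', hy'⟩, rfl⟩

end SymComb

theorem mainTheorem3 (μ : SymComb.Net) (σ : SymComb.Feedback)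
    (hσ : ↑σ.dom ⊆ μ.interface) :
    (μ.plug σ hσ).edifice = SymComb.trace σ μ.edifice := by
  have hint : ∀ {i}, i ∈ (μ.plug σ hσ).interface ↔ i ∈ μ.interface ∧ i ∉ σ.dom :=
    μ.isNet.mem_interface_plug_iff hσ
  have hrun : ∀ {x y L}, x.2 ∉ σ.dom → y.2 ∉ σ.dom →
      ((μ.plug σ hσ).Run x y L ↔ SymComb.Alt μ.Run (SymComb.Jump σ) x y L) := fun hx hy => by
    unfold SymComb.PreNet.Run
    rw [SymComb.Alt.alt_alt]
    exact (SymComb.PreNet.run_plug_iff (μ.isNet.notMem_dom hσ) hx).trans (and_iff_left hy)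
  ext e
  rw [SymComb.Net.mem_trace_iff hσ]
  constructor
  · intro he
    induction e using Sym2.ind with
    | _ x y =>
      obtain ⟨hx, hy, L, h⟩ := SymComb.Net.mem_edifice_iff.1 he
      rw [hint] at hx hy
      exact ⟨x, y, rfl, hx, hy, L, (hrun hx.2 hy.2).1 h⟩
  · rintro ⟨x, y, rfl, hx, hy, L, h⟩
    exact SymComb.Net.mem_edifice_iff.2 ⟨hint.2 hx, hint.2 hy, L, (hrun hx.2 hy.2).2 h⟩
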